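/- Let $\mathcal H$ be a finite-dimensional complex Hilbert space of dimension $d$, and let $\mathcal S(\mathcal H)$ be the set of states (positive operators of trace one). Let $(\mathcal P_t)_{t\ge 0}$ be a continuous quantum Markov semigroup on $\mathcal B(\mathcal H)$, i.e. a continuous one-parameter semigroup of completely positive linear maps with $\mathcal P_t(I)=I$, and assume that it has a faithful invariant state $\sigma$: $\sigma>0$, $\operatorname{Tr}\sigma=1$ and $\operatorname{Tr}[\sigma\,\mathcal P_t(X)]=\operatorname{Tr}[\sigma X]$ for all $t\ge0$ and $X\in\mathcal B(\mathcal H)$. For a linear map $\varphi$ on $\mathcal B(\mathcal H)$ let $\varphi_*$ be its predual, $\operatorname{Tr}[\varphi(X)Y]=\operatorname{Tr}[X\varphi_*(Y)]$ for all $X,Y$; write $\mathcal P_{*t}=(\mathcal P_t)_*$, and let $\mathcal L_*(\rho)=\lim_{t\to0^+}\frac1t(\mathcal P_{*t}(\rho)-\rho)$ be the generator of $(\mathcal P_{*t})_{t\ge0}$. Let $$\mathcal N=\{X:\ \mathcal P_t(X^*Y)=\mathcal P_t(X)^*\mathcal P_t(Y),\ \mathcal P_t(YX^*)=\mathcal P_t(Y)\mathcal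 P_t(X)^*\ \ \forall t\ge0,\ \forall Y\in\mathcal B(\mathcal H)\}$$ be the decoherence-free (DF) algebra, and let $E_{\mathcal N}$ be the unique conditional expectation (completely positive projection) from $\mathcal B(\mathcal H)$ onto $\mathcal N$ such that $\operatorname{Tr}[\sigma E_{\mathcal N}(X)]=\operatorname{Tr}[\sigma X]$ for all $X$, and $E_{\mathcal N}(X)=0$ if and only if $\lim_{t\to\infty}\mathcal P_t(X)=0$. For a state $\rho$ put $\rho_{\mathcal N}=(E_{\mathcal N})_*(\rho)$, and let $\sigma_{\operatorname{Tr}}=(E_{\mathcal N})_*(I/d)$. For states $\rho,\tau$ let $D(\rho\|\tau)=\operatorname{Tr}[\rho(\log\rho-\log\tau)]$ if $\operatorname{supp}\rho\subset\operatorname{supp}\tau$ (logarithms being taken on the supports) and $D(\rho\|\tau)=+\infty$ otherwise. For a state $\rho$ let the entropy production be $$\operatorname{EP}_{\mathcal L}(\rho)=-\operatorname{Tr}\big[\mathcal L_*(\rho)(\log\rho-\log\sigma_{\operatorname{Tr}})\big]\in(-\infty,+\infty],$$ where, if $\rho$ is not faithful, the formula is read with $\log 0=-\infty$ and $0\cdot(-\infty)=0$: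 if $\langle v,\mathcal L_*(\rho)v\rangle=0$ for all $v\in\ker\rho$, then $\log\rho$ is the logarithm on the support of $\rho$ (and $0$ on $\ker\rho$); otherwise $\operatorname{EP}_{\mathcal L}(\rho)=+\infty$. Then, for every $\alpha>0$, the modified DF log-Sobolev inequality $$2\alpha\,D(\rho\|\rho_{\mathcal N})\le\operatorname{EP}_{\mathcal L}(\rho)\qquad\text{for all }\rho\in\mathcal S(\mathcal H)$$ holds if and only if $$D\big(\mathcal P_{*t}(\rho)\,\big\|\,(\mathcal P_{*t}(\rho))_{\mathcal N}\big)\le e^{-2\alpha t}\,D(\rho\|\rho_{\mathcal N})\qquad\text{for all }\rho\in\mathcal S(\mathcal H)\text{ and all }t\ge0.$$ -/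

import Mathlib

open scoped NNReal InnerProductSpace CStarAlgebra
open Filter Topology

namespace DFEntropy

noncomputable section

/-- The algebra `B(H)` of (bounded) operators on `H`. -/
abbrev Op (H : Type*) [NormedAddCommGroup H] [InnerProductSpace ℂ H] := H →L[ℂ] H

section Trace

variable {H : Type*} [NormedAddCommGroup H] [InnerProductSpace ℂ H]

/-- The trace on `B(H)`. -/
def tr : Op H →ₗ[ℂ] ℂ := LinearMap.trace ℂ H ∘ₗ ContinuousLinearMap.coeLM ℂ

theorem tr_apply (X : Op H) : tr X = LinearMap.trace ℂ H (X : H →ₗ[ℂ] H) := rfl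

theorem tr_mul_comm (X Y : Op H) : tr (X * Y) = tr (Y * X) :=
  LinearMap.trace_mul_comm ℂ (X : H →ₗ[ℂ] H) (Y : H →ₗ[ℂ] H)

/-- The trace pairing `(X, Y) ↦ Tr[X Y]` on `B(H)`. -/
def trForm : LinearMap.BilinForm ℂ (Op H) := (LinearMap.mul ℂ (Op H)).compr₂ tr

theorem trForm_apply (X Y : Op H) : trForm X Y = tr (X * Y) := rfl

theorem eq_zero_of_tr_mul [FiniteDimensional ℂ H] (X : Op H) (h : ∀ Y, tr (X * Y) = 0) :
    X = 0 := by
  ext v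
  have h1 := h (InnerProductSpace.rankOne ℂ v (X v))
  have h2 : X * InnerProductSpace.rankOne ℂ v (X v)
      = InnerProductSpace.rankOne ℂ (X v) (X v) := by
    ext w; simp
  rw [h2, tr_apply, InnerProductSpace.trace_rankOne] at h1
  simpa using h1

theorem trForm_nondegenerate [FiniteDimensional ℂ H] : (trForm (H := H)).Nondegenerate :=
  ⟨fun X hX => eq_zero_of_tr_mul X hX,
    fun X hX => eq_zero_of_tr_mul X fun Y => by rw [tr_mul_comm]; exact hX Y⟩

/-- The predual `φ_*` of a linear map `φ` on `B(H)`: the unique linear map with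
`Tr[φ(X) Y] = Tr[X φ_*(Y)]` for all `X, Y`. -/
def predual [FiniteDimensional ℂ H] (φ : Op H →ₗ[ℂ] Op H) : Op H →ₗ[ℂ] Op H :=
  trForm.leftAdjointOfNondegenerate trForm_nondegenerate φ

theorem predual_spec [FiniteDimensional ℂ H] (φ : Op H →ₗ[ℂ] Op H) (X Y : Op H) :
    tr (φ X * Y) = tr (X * predual φ Y) := by
  rw [tr_mul_comm, tr_mul_comm X]
  exact (trForm.isAdjointPairLeftAdjointOfNondegenerate trForm_nondegenerate φ Y X).symm

end Trace

variable {H : Type*} [NormedAddCommGroup H] [InnerProductSpace ℂ H] [CompleteSpace H]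

/-- `ρ` is a state (density matrix): positive, of trace one. -/
def IsState (ρ : Op H) : Prop := 0 ≤ ρ ∧ tr ρ = 1

/-- A continuous quantum Markov semigroup on `B(H)` in the Heisenberg picture: a continuous
one-parameter semigroup of completely positive, identity-preserving linear maps. -/
structure QMS (H : Type*) [NormedAddCommGroup H] [InnerProductSpace ℂ H] [CompleteSpace H] where
  /-- The map `P_t`. -/
  P : ℝ≥0 → (Op H →CP Op H)
  map_one : ∀ t, P t 1 = 1
  zero : ∀ X, P 0 X = X
  add : ∀ s t X, P (s + t) X = P s (P t X)
  continuous : ∀ X, Continuous fun t => P t X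

namespace QMS

/-- The decoherence-free algebra `N(P)`. -/
def dfAlgebra (Q : QMS H) : Set (Op H) :=
  {X | ∀ (t : ℝ≥0) (Y : Op H), Q.P t (star X * Y) = star (Q.P t X) * Q.P t Y ∧
    Q.P t (Y * star X) = Q.P t Y * star (Q.P t X)}

/-- `E` is the conditional expectation from `B(H)` onto `N(P)` that is compatible with the state
`σ`, and whose kernel consists of the observables that vanish in the long-time limit. -/
structure IsDFExpectation (Q : QMS H) (σ : Op H) (E : Op H →CP Op H) : Prop where
  idem : ∀ X, E (E X) = E X
  compatible : ∀ X, tr (σ * E X) = tr (σ * X)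
  range_eq : Set.range E = Q.dfAlgebra
  ker_iff : ∀ X, E X = 0 ↔ Tendsto (fun t : ℝ≥0 => Q.P t X) atTop (𝓝 0)

theorem IsDFExpectation.unique {Q : QMS H} {σ : Op H} {E F : Op H →CP Op H}
    (hE : Q.IsDFExpectation σ E) (hF : Q.IsDFExpectation σ F) : E = F := by
  refine DFunLike.ext _ _ fun X => ?_
  have h1 : E (X - F X) = 0 := by
    rw [hE.ker_iff, ← hF.ker_iff, map_sub, hF.idem, sub_self]
  have h2 : F X ∈ Set.range E := by
    rw [hE.range_eq, ← hF.range_eq]; exact ⟨X, rfl⟩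
  obtain ⟨Z, hZ⟩ := h2
  rw [map_sub, sub_eq_zero] at h1
  rw [h1, ← hZ, hE.idem]

open Classical in
/-- The conditional expectation `E_N` onto the decoherence-free algebra; it is unique by
`IsDFExpectation.unique` (the value `0` is used only if there were none, which does not happen
when `σ` is a faithful invariant state). -/
def dfExpectation (Q : QMS H) (σ : Op H) : Op H →ₗ[ℂ] Op H :=
  if h : ∃ E, Q.IsDFExpectation σ E then h.choose.toLinearMap else 0

variable [FiniteDimensional ℂ H]

/-- The semigroup `P_{*t}` in the Schrödinger picture. -/
def dual (Q : QMS H) (t : ℝ≥0) : Op H →ₗ[ℂ] Op H := predual (Q.P t).toLinearMap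

/-- The generator `L_*` of the semigroup `P_{*t}`, i.e. its (one-sided) derivative at `t = 0`. -/
def dualGenerator (Q : QMS H) (ρ : Op H) : Op H :=
  derivWithin (fun t : ℝ => Q.dual t.toNNReal ρ) (Set.Ici 0) 0

/-- `σ` is an invariant state of the semigroup: `σ(P_t(X)) = σ(X)`. -/
def IsInvariantState (Q : QMS H) (σ : Op H) : Prop :=
  IsState σ ∧ ∀ (t : ℝ≥0) (X : Op H), tr (σ * Q.P t X) = tr (σ * X)

/-- The predual `E_{N*}` of the conditional expectation; `ρ_N = E_{N*}(ρ)`. -/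
def dfDual (Q : QMS H) (σ : Op H) : Op H →ₗ[ℂ] Op H := predual (Q.dfExpectation σ)

/-- The reference state `σ_Tr = E_{N*}(I / d)`, `d = dim H`. -/
def refState (Q : QMS H) (σ : Op H) : Op H :=
  Q.dfDual σ ((Module.finrank ℂ H : ℂ)⁻¹ • 1)

end QMS

/-- The support of a self-adjoint operator: the orthogonal complement of its kernel. -/
def supp (A : Op H) : Submodule ℂ H := (LinearMap.ker (A : H →ₗ[ℂ] H))ᗮ

open Classical in
/-- The relative entropy `D(ρ‖σ) = Tr[ρ (log ρ - log σ)]` if `supp ρ ⊆ supp σ`, and `+∞` otherwise.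
`CFC.log` of a positive operator is the logarithm on its support (and zero on its kernel). -/
def relEntropy (ρ σ : Op H) : EReal :=
  if supp ρ ≤ supp σ then (((tr (ρ * (CFC.log ρ - CFC.log σ))).re : ℝ) : EReal) else ⊤

variable [FiniteDimensional ℂ H]

namespace QMS

open Classical in
/-- The entropy production `EP_L(ρ) = -Tr[L_*(ρ) (log ρ - log σ)]` for `σ = σ_Tr`.
For states that are not faithful the formula is read with `log 0 = -∞` and `0 · (-∞) = 0`: as
`⟪v, L_*(ρ) v⟫ ≥ 0` for `v` in the kernel of `ρ`, the value is `+∞` unless all of these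
numbers vanish, in which case `log ρ` is the logarithm on the support of `ρ`. -/
def entropyProduction (Q : QMS H) (σ ρ : Op H) : EReal :=
  if ∀ v : H, ρ v = 0 → ⟪v, Q.dualGenerator ρ v⟫_ℂ = 0 then
    ((-(tr (Q.dualGenerator ρ * (CFC.log ρ - CFC.log (Q.refState σ)))).re : ℝ) : EReal)
  else ⊤

/-- The decoherence-free relative entropy `D(ρ‖ρ_N)`. -/
def dfEntropy (Q : QMS H) (σ ρ : Op H) : EReal := relEntropy ρ (Q.dfDual σ ρ)

/-- The modified decoherence-free log-Sobolev inequality with constant `α`. -/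
def MLSI (Q : QMS H) (σ : Op H) (α : ℝ) : Prop :=
  ∀ ρ : Op H, IsState ρ →
    ((2 * α : ℝ) : EReal) * Q.dfEntropy σ ρ ≤ Q.entropyProduction σ ρ

end QMS

end

end DFEntropy

/-!
The modified logarithmic Sobolev inequality is the infinitesimal form of exponential decay of
`t ↦ D(ρ_t ‖ (ρ_t)_N)`, `ρ_t = P_{*t}(ρ)`: its derivative is minus the entropy production.

Write `N` for the decoherence-free algebra and `κ = E_{N*}(1) = d σ_Tr`. The functional `Tr[ρ ·]`
on `N` has a density `h ∈ N` (`exists_density`). By the bimodule property of `E_N`, `κ` commutes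
with `N` and `ρ_N = h κ` (`commute_dfDual_one`, `dfDual_eq_mul`). Hence the logarithm of `ρ_N`
splits and `D(ρ ‖ ρ_N) = Tr[ρ log ρ] - Tr[h log h] - Tr[ρ log κ]`, which is finite for every state
(`relEntropy_mul`, `dfEntropy_eq`). On `N` each `P_t` is a surjective homomorphism, and it preserves
the trace, because traces of projections are integers depending continuously on `t`. So the
densities of the states `ρ_t` all have the same entropy (`tr_mul_log_density_eq`), and in the
relative entropy only `Tr[ρ_t (log ρ_t - log κ)]` depends on time.

The comparison with the entropy production rests on Klein's inequality (`klein`) alone.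
* From the inequality to decay: for faithful `ρ`, `D(ρ_t ‖ ρ_s) ≥ 0` bounds the upper right
  derivative of `Tr[ρ_t log ρ_t]` by `Tr[L_*(ρ_t) log ρ_t]`, and Grönwall's inequality applies
  (`entropyValue_dual_le_of_faithful`). The general case follows by continuity along
  `(1 - ε) ρ + ε σ`.
* From decay to the inequality: if the entropy production of `ρ` is finite, `ρ_t` puts only mass
  `O(t ^ 2)` on the kernel of `ρ`. Comparing `ρ_t` with `ρ`, the eigenvalue `0` being replaced by
  `t ^ 2`, shows that the initial rate of loss of relative entropy is at most the entropy
  production, the error being `O(t log t)` (`klein_lift`, `entropyValue_le_of_decay`).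

The conditional expectation `E_N` exists (`exists_isDFExpectation`): an idempotent limit point of
`P_t` as `t → ∞` is one, by the Kadison–Schwarz inequality and Choi's description of its equality
case.
-/

namespace DFEntropy

noncomputable section

open scoped ComplexOrder

/-! ### Completely positive maps: Kadison–Schwarz and the multiplicative domain -/

section

section CompletelyPositive

variable {A : Type*} [CStarAlgebra A] [PartialOrder A] [StarOrderedRing A]

/-- The matrix of Gram type to which complete positivity is applied in the Kadison–Schwarz
inequality. -/
theorem cstarMatrix_nonneg (b : A) :
    0 ≤ (CStarMatrix.ofMatrix !![star b * b, star b; b, 1] : CStarMatrix (Fin 2) (Fin 2) A) := by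
  have h : (CStarMatrix.ofMatrix !![star b * b, star b; b, 1] : CStarMatrix (Fin 2) (Fin 2) A)
      = star (CStarMatrix.ofMatrix !![b, 1; 0, 0]) * CStarMatrix.ofMatrix !![b, 1; 0, 0] := by
    ext i j
    fin_cases i <;> fin_cases j <;> simp [CStarMatrix.mul_apply, CStarMatrix.star_apply]
  rw [h]
  exact star_mul_self_nonneg _

theorem cstarMatrix_diag_nonneg {n : Type*} [Fintype n] {M : CStarMatrix n n A} (hM : 0 ≤ M)
    (i : n) : 0 ≤ M i i := by
  rw [StarOrderedRing.nonneg_iff] at hM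
  induction hM using AddSubmonoid.closure_induction with
  | mem x hx =>
    obtain ⟨B, rfl⟩ := hx
    change 0 ≤ (star B * B) i i
    rw [CStarMatrix.mul_apply]
    refine Finset.sum_nonneg fun k _ => ?_
    rw [CStarMatrix.star_apply]
    exact star_mul_self_nonneg _
  | zero => simp
  | add x y _ _ hx hy => exact add_nonneg hx hy

/-- The Kadison–Schwarz inequality; only 2-positivity of `φ` is used. -/
theorem kadison_schwarz (φ : A →CP A) (h1 : φ 1 = 1) (b : A) :
    star (φ b) * φ b ≤ φ (star b * b) := by
  have h := φ.map_cstarMatrix_nonneg _ (cstarMatrix_nonneg b)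
  -- conjugating by the column `(1, -φ b)` leaves `φ (b* b) - φ(b)* φ(b)` in the corner
  have h2 := cstarMatrix_diag_nonneg (star_left_conjugate_nonneg h
    (CStarMatrix.ofMatrix !![1, 0; -φ b, 0])) 0
  have h3 : φ (star b) = star (φ b) := map_star φ b
  simp [CStarMatrix.mul_apply, CStarMatrix.star_apply, CStarMatrix.map_apply, h1, h3] at h2
  exact h2

theorem norm_ucp_le (φ : A →CP A) (h1 : φ 1 = 1) (b : A) : ‖φ b‖ ≤ ‖b‖ := by
  have h : star (φ b) * φ b ≤ algebraMap ℝ A (‖b‖ ^ 2) := by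
    refine (kadison_schwarz φ h1 b).trans ?_
    have h2 : star b * b ≤ algebraMap ℝ A (‖b‖ ^ 2) := CStarAlgebra.star_mul_le_algebraMap_norm_sq
    have h3 := OrderHomClass.mono φ h2
    have h4 : φ (algebraMap ℝ A (‖b‖ ^ 2)) = algebraMap ℝ A (‖b‖ ^ 2) := by
      rw [IsScalarTower.algebraMap_apply ℝ ℂ A, Algebra.algebraMap_eq_smul_one (R := ℂ),
        map_smul, h1]
    exact h3.trans_eq h4
  have h5 := (CStarAlgebra.norm_le_iff_le_algebraMap _ (by positivity)
    (star_mul_self_nonneg _)).mpr h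
  rw [CStarRing.norm_star_mul_self, ← sq] at h5
  exact (sq_le_sq₀ (norm_nonneg _) (norm_nonneg _)).mp h5

/-- The perturbation argument behind the multiplicative domain: letting `t → 0` and varying the
phase `w` kills the off-diagonal part `d` of a positive sesquilinear form. -/
theorem eq_zero_of_forall_nonneg {d e : A}
    (h : ∀ (w : ℂ) (t : ℝ), 0 < t →
      0 ≤ w • d + star w • star d + (t * (w * star w)) • e) : d = 0 := by
  have h0 : ∀ w : ℂ, 0 ≤ w • d + star w • star d := by
    intro w
    have hc : Tendsto (fun t : ℝ => w • d + star w • star d + (t * (w * star w)) • e)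
        (𝓝[>] 0)
        (𝓝 (w • d + star w • star d + (((0 : ℝ) : ℂ) * (w * star w)) • e)) := by
      refine (Continuous.tendsto ?_ 0).mono_left nhdsWithin_le_nhds
      fun_prop
    have := ge_of_tendsto hc (eventually_nhdsWithin_of_forall fun t ht => h w t ht)
    simpa using this
  have hz : ∀ w : ℂ, w • d + star w • star d = 0 := by
    intro w
    refine le_antisymm ?_ (h0 w)
    have := h0 (-w)
    simp only [star_neg, neg_smul, ← neg_add] at this
    exact neg_nonneg.mp this
  have e1 := hz 1
  have e2 := hz Complex.I
  simp only [star_one, one_smul] at e1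
  have e3 : star d = -d := by rw [eq_neg_iff_add_eq_zero, add_comm]; exact e1
  simp only [e3, Complex.star_def, Complex.conj_I, neg_smul, smul_neg, neg_neg] at e2
  rw [← add_smul, smul_eq_zero] at e2
  refine e2.resolve_left ?_
  rw [← two_mul]
  simp

/-- Choi's multiplicative domain: equality in the Kadison–Schwarz inequality for `b` makes `φ`
multiplicative on all products with `b*` on the left. -/
theorem map_star_mul_of_eq (φ : A →CP A) (h1 : φ 1 = 1) {b : A}
    (hb : φ (star b * b) = star (φ b) * φ b) (c : A) :
    φ (star b * c) = star (φ b) * φ c := by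
  rw [← sub_eq_zero]
  have hs : ∀ x, φ (star x) = star (φ x) := fun x => map_star φ x
  refine eq_zero_of_forall_nonneg (e := φ (star c * c) - star (φ c) * φ c) fun w t ht => ?_
  -- the positive form `(x, y) ↦ φ (x* y) - φ(x)* φ(y)` at `b + t w c`, divided by `t`
  have hk := smul_nonneg (inv_nonneg.mpr ht.le)
    (sub_nonneg.mpr (kadison_schwarz φ h1 (b + ((t : ℂ) * w) • c)))
  have ht' : (t : ℂ) ≠ 0 := by exact_mod_cast ht.ne'
  refine hk.trans_eq ?_
  have e1 : star (φ (star b * c)) = φ (star c * b) := by rw [← hs]; simp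
  rw [← Complex.coe_smul, eq_comm, ← smul_right_inj ht', smul_smul]
  push_cast
  rw [mul_inv_cancel₀ ht', one_smul]
  simp only [star_add, star_smul, star_mul', Complex.star_def, Complex.conj_ofReal, add_mul,
    mul_add, smul_mul_assoc, mul_smul_comm, map_add, map_smul, hb, smul_sub, star_sub, star_mul,
    star_star, e1, smul_smul, smul_add]
  match_scalars <;> ring

theorem map_mul_star_of_eq (φ : A →CP A) (h1 : φ 1 = 1) {b : A}
    (hb : φ (b * star b) = φ b * star (φ b)) (c : A) :
    φ (c * star b) = φ c * star (φ b) := by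
  have hs : ∀ x, φ (star x) = star (φ x) := fun x => map_star φ x
  have h := congrArg star (map_star_mul_of_eq φ h1 (b := star b) (by simpa [hs] using hb) (star c))
  rw [← hs] at h
  simpa [hs] using h

/-- Complete positivity is preserved by limits of linear maps. -/
theorem isClosed_completelyPositive :
    IsClosed {T : A →L[ℂ] A | ∀ (k : ℕ) (M : CStarMatrix (Fin k) (Fin k) A),
      0 ≤ M → 0 ≤ M.map T} := by
  simp only [Set.ofPred_forall]
  refine isClosed_iInter fun k => isClosed_iInter fun M => isClosed_iInter fun _ => ?_
  have hc : Continuous fun T : A →L[ℂ] A => M.map T := by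
    refine continuous_matrix fun i j => ?_
    change Continuous fun T : A →L[ℂ] A => T (M i j)
    fun_prop
  have hn : IsClosed {B : CStarMatrix (Fin k) (Fin k) A | 0 ≤ B} := CStarAlgebra.isClosed_nonneg
  exact hn.preimage hc

end CompletelyPositive

end

/-! ### The decoherence-free algebra and existence of the conditional expectation -/

section

section TracePositivity

variable {H : Type*} [NormedAddCommGroup H] [InnerProductSpace ℂ H] [FiniteDimensional ℂ H]

theorem tr_eq_sum_inner (X : Op H) :
    tr X = ∑ i, ⟪stdOrthonormalBasis ℂ H i, X (stdOrthonormalBasis ℂ H i)⟫_ℂ :=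
  LinearMap.trace_eq_sum_inner _ (stdOrthonormalBasis ℂ H)

theorem continuous_tr : Continuous (tr : Op H → ℂ) :=
  (LinearMap.toContinuousLinearMap (tr : Op H →ₗ[ℂ] ℂ)).continuous

theorem _root_.Continuous.opTr {α : Type*} [TopologicalSpace α] {f : α → Op H}
    (hf : Continuous f) : Continuous fun x => tr (f x) :=
  continuous_tr.comp hf

theorem eq_of_tr_mul_eq_tr_mul {A B : Op H} (h : ∀ Y, tr (A * Y) = tr (B * Y)) : A = B := by
  rw [← sub_eq_zero]
  refine eq_zero_of_tr_mul _ fun Y => ?_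
  rw [sub_mul, map_sub, h, sub_self]

variable [CompleteSpace H]

theorem tr_star_mul_self (X : Op H) :
    tr (star X * X) = ((∑ i, ‖X (stdOrthonormalBasis ℂ H i)‖ ^ 2 : ℝ) : ℂ) := by
  rw [tr_eq_sum_inner]
  push_cast
  refine Finset.sum_congr rfl fun i _ => ?_
  rw [Function.comp_apply, ContinuousLinearMap.star_eq_adjoint,
    ContinuousLinearMap.adjoint_inner_right, inner_self_eq_norm_sq_to_K]
  rfl

theorem tr_star_mul_self_nonneg (X : Op H) : 0 ≤ tr (star X * X) := by
  rw [tr_star_mul_self, Complex.zero_le_real]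
  positivity

theorem eq_zero_of_tr_star_mul_self {X : Op H} (h : tr (star X * X) = 0) : X = 0 := by
  rw [tr_star_mul_self, Complex.ofReal_eq_zero,
    Finset.sum_eq_zero_iff_of_nonneg (fun _ _ => by positivity)] at h
  have h1 : (X : H →ₗ[ℂ] H) = 0 := (stdOrthonormalBasis ℂ H).toBasis.ext fun i => by
    simpa using h i (Finset.mem_univ _)
  exact ContinuousLinearMap.coe_injective h1

theorem tr_nonneg {A : Op H} (hA : 0 ≤ A) : 0 ≤ tr A := by
  obtain ⟨C, rfl⟩ := CStarAlgebra.nonneg_iff_eq_star_mul_self.mp hA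
  exact tr_star_mul_self_nonneg C

theorem tr_mul_nonneg {A B : Op H} (hA : 0 ≤ A) (hB : 0 ≤ B) : 0 ≤ tr (A * B) := by
  obtain ⟨C, rfl⟩ := CStarAlgebra.nonneg_iff_eq_star_mul_self.mp hA
  rw [mul_assoc, tr_mul_comm, mul_assoc]
  refine tr_nonneg ?_
  rw [← mul_assoc]
  exact star_right_conjugate_nonneg hB C

theorem mul_eq_zero_of_tr_mul_eq_zero {A B : Op H} (hA : 0 ≤ A) (hB : 0 ≤ B)
    (h : tr (A * B) = 0) : A * B = 0 := by
  obtain ⟨C, rfl⟩ := CStarAlgebra.nonneg_iff_eq_star_mul_self.mp hA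
  obtain ⟨D, rfl⟩ := CStarAlgebra.nonneg_iff_eq_star_mul_self.mp hB
  have h1 : D * star C = 0 := by
    refine eq_zero_of_tr_star_mul_self ?_
    rw [tr_mul_comm, star_mul, star_star, mul_assoc, tr_mul_comm]
    rw [← h, tr_mul_comm]
    simp only [mul_assoc]
    rw [tr_mul_comm]
    simp only [mul_assoc]
  have h2 : C * star D = 0 := by simpa using congrArg star h1
  rw [mul_assoc, ← mul_assoc C, h2, zero_mul, mul_zero]

theorem eq_zero_of_tr_mul_eq_zero {σ A : Op H} (hσ : IsStrictlyPositive σ) (hA : 0 ≤ A)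
    (h : tr (σ * A) = 0) : A = 0 :=
  hσ.isUnit.mul_right_eq_zero.mp (mul_eq_zero_of_tr_mul_eq_zero hσ.nonneg hA h)

theorem tr_mul_mono {σ A B : Op H} (hσ : 0 ≤ σ) (h : A ≤ B) : tr (σ * A) ≤ tr (σ * B) := by
  have := tr_mul_nonneg hσ (sub_nonneg.mpr h)
  rwa [mul_sub, map_sub, sub_nonneg] at this

/-- For a faithful functional, ordered operators with the same expectation are equal. -/
theorem eq_of_tr_mul_eq {σ A B : Op H} (hσ : IsStrictlyPositive σ) (h : A ≤ B)
    (h2 : tr (σ * B) ≤ tr (σ * A)) : A = B := by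
  have h0 := le_antisymm h2 (tr_mul_mono hσ.nonneg h)
  refine (sub_eq_zero.mp (eq_zero_of_tr_mul_eq_zero hσ (sub_nonneg.mpr h) ?_)).symm
  rw [mul_sub, map_sub, h0, sub_self]

omit [CompleteSpace H] in
/-- Positivity is detected by the trace pairing with positive operators. -/
theorem nonneg_of_tr_mul_nonneg {A : Op H} (h : ∀ B : Op H, 0 ≤ B → 0 ≤ tr (A * B)) :
    0 ≤ A := by
  rw [ContinuousLinearMap.nonneg_iff_isPositive, ContinuousLinearMap.isPositive_iff_complex]
  intro v
  have h1 := h (InnerProductSpace.rankOne ℂ v v)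
    ((ContinuousLinearMap.nonneg_iff_isPositive _).mpr
      (InnerProductSpace.isPositive_rankOne_self v))
  have h2 : A * InnerProductSpace.rankOne ℂ v v = InnerProductSpace.rankOne ℂ (A v) v := by
    ext w; simp
  rw [h2, tr_apply, InnerProductSpace.trace_rankOne] at h1
  have h3 : 0 ≤ ⟪A v, v⟫_ℂ := by
    rw [← inner_conj_symm]
    exact star_nonneg_iff.mpr h1
  obtain ⟨hr, hi⟩ := Complex.nonneg_iff.mp h3
  exact ⟨Complex.ext rfl hi, hr⟩

end TracePositivity

variable {H : Type*} [NormedAddCommGroup H] [InnerProductSpace ℂ H] [CompleteSpace H]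

namespace QMS

variable (Q : QMS H)

theorem P_star (t : ℝ≥0) (X : Op H) : Q.P t (star X) = star (Q.P t X) := map_star (Q.P t) X

/-- The decoherence-free algebra, as a star subalgebra of `B(H)`. -/
def dfStarSubalgebra : StarSubalgebra ℂ (Op H) where
  carrier := Q.dfAlgebra
  mul_mem' {X Z} hX hZ t Y := by
    have e : Q.P t (X * Z) = Q.P t X * Q.P t Z := by
      have h := (hZ t (star X)).1
      rw [← star_mul, P_star, P_star, ← star_mul] at h
      have h := (hX t (star Z)).2
      rw [← star_mul, P_star, P_star, ← star_mul, star_inj] at h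
      exact h
    constructor
    · rw [star_mul, mul_assoc, (hZ t _).1, (hX t _).1, e, star_mul, mul_assoc]
    · rw [star_mul, ← mul_assoc, (hX t _).2, (hZ t _).2, e, star_mul, mul_assoc]
  add_mem' {X Z} hX hZ t Y := by
    simp only [star_add, map_add, add_mul, mul_add, (hX t Y).1, (hX t Y).2, (hZ t Y).1,
      (hZ t Y).2, and_self]
  algebraMap_mem' c t Y := by
    simp [Algebra.algebraMap_eq_smul_one, Q.map_one]
  star_mem' {X} hX t Y := by
    constructor
    · have h := congrArg star (hX t (star Y)).2
      simpa [← P_star] using h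
    · have h := congrArg star (hX t (star Y)).1
      simpa [← P_star] using h

theorem P_mul_of_mem_left {X : Op H} (hX : X ∈ Q.dfStarSubalgebra) (t : ℝ≥0) (Y : Op H) :
    Q.P t (X * Y) = Q.P t X * Q.P t Y := by
  have h := (star_mem hX t Y).1
  rwa [star_star, P_star, star_star] at h

/-- Equality in the Kadison–Schwarz inequalities for `X` and `X*` at all times is enough for `X` to
belong to the decoherence-free algebra. -/
theorem mem_df_of_eq {X : Op H}
    (h1 : ∀ t, Q.P t (star X * X) = star (Q.P t X) * Q.P t X)
    (h2 : ∀ t, Q.P t (X * star X) = Q.P t X * star (Q.P t X)) : X ∈ Q.dfStarSubalgebra :=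
  fun t Y => ⟨map_star_mul_of_eq (Q.P t) (Q.map_one t) (h1 t) Y,
    map_mul_star_of_eq (Q.P t) (Q.map_one t) (h2 t) Y⟩

theorem P_mem {X : Op H} (hX : X ∈ Q.dfStarSubalgebra) (t : ℝ≥0) :
    Q.P t X ∈ Q.dfStarSubalgebra := by
  refine Q.mem_df_of_eq (fun s => ?_) (fun s => ?_)
  · rw [← (hX t X).1, ← Q.add, ← Q.add, (hX _ X).1]
  · rw [← (hX t X).2, ← Q.add, ← Q.add, (hX _ X).2]

theorem norm_P_le (t : ℝ≥0) (X : Op H) : ‖Q.P t X‖ ≤ ‖X‖ := norm_ucp_le _ (Q.map_one t) X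

theorem norm_P_add_le (s t : ℝ≥0) (X : Op H) : ‖Q.P (s + t) X‖ ≤ ‖Q.P t X‖ := by
  rw [Q.add]; exact Q.norm_P_le _ _

variable [FiniteDimensional ℂ H]

/-- `P_t` as a continuous linear map. -/
def Pc (t : ℝ≥0) : Op H →L[ℂ] Op H := LinearMap.toContinuousLinearMap (Q.P t).toLinearMap

theorem Pc_apply (t : ℝ≥0) (X : Op H) : Q.Pc t X = Q.P t X := rfl

theorem Pc_add (s t : ℝ≥0) : Q.Pc (s + t) = Q.Pc s * Q.Pc t :=
  ContinuousLinearMap.ext fun X => Q.add s t X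

theorem norm_Pc_le (t : ℝ≥0) : ‖Q.Pc t‖ ≤ 1 :=
  ContinuousLinearMap.opNorm_le_bound _ zero_le_one fun X => by
    rw [one_mul]; exact Q.norm_P_le t X

/-- The maps `P_s` with `s ≥ t`. -/
def tail (t : ℝ≥0) : Set (Op H →L[ℂ] Op H) := Q.Pc '' Set.Ici t

theorem tail_anti {s t : ℝ≥0} (h : s ≤ t) : Q.tail t ⊆ Q.tail s :=
  Set.image_mono (Set.Ici_subset_Ici.mpr h)

/-- The set of limit points of `P_t` as `t → ∞` is a nonempty compact semigroup, hence contains an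
idempotent by the Ellis–Numakura lemma. -/
theorem exists_idempotent_limit :
    ∃ T : Op H →L[ℂ] Op H, T * T = T ∧ ∀ t, T ∈ closure (Q.tail t) := by
  have hcomp : ∀ t, IsCompact (closure (Q.tail t)) := fun t =>
    Metric.isCompact_of_isClosed_isBounded isClosed_closure
      ((Metric.isBounded_closedBall (x := (0 : Op H →L[ℂ] Op H)) (r := 1)).subset (by
        refine closure_minimal ?_ Metric.isClosed_closedBall
        rintro _ ⟨s, -, rfl⟩
        simpa using Q.norm_Pc_le s))
  obtain ⟨T, hT, hTT⟩ := exists_idempotent_in_compact_subsemigroup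
    (M := Op H →L[ℂ] Op H) (fun r => continuous_mul_const r) (⋂ t, closure (Q.tail t))
    (IsCompact.nonempty_iInter_of_directed_nonempty_isCompact_isClosed _
      (fun s t => ⟨max s t, closure_mono (Q.tail_anti (le_max_left _ _)),
        closure_mono (Q.tail_anti (le_max_right _ _))⟩)
      (fun t => ⟨_, subset_closure ⟨t, Set.self_mem_Ici, rfl⟩⟩) hcomp
      (fun t => isClosed_closure))
    ((hcomp 0).of_isClosed_subset (isClosed_iInter fun _ => isClosed_closure)
      (Set.iInter_subset _ 0)) (fun x hx y hy => Set.mem_iInter.mpr fun t => by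
      refine map_mem_closure₂ continuous_mul (Set.mem_iInter.mp hx t) (Set.mem_iInter.mp hy t) ?_
      rintro _ ⟨a, ha, rfl⟩ _ ⟨b, hb, rfl⟩
      exact ⟨a + b, Set.mem_Ici.mpr (le_add_right ha), Q.Pc_add a b⟩)
  exact ⟨T, hTT, Set.mem_iInter.mp hT⟩

/-- The conditional expectation onto the decoherence-free algebra exists: any idempotent limit point
of `P_t` is one. -/
theorem exists_isDFExpectation {σ : Op H} (hσ : Q.IsInvariantState σ)
    (hσf : IsStrictlyPositive σ) : ∃ E, Q.IsDFExpectation σ E := by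
  obtain ⟨T, hTT, hT⟩ := Q.exists_idempotent_limit
  have hcp := closure_minimal (s := Q.tail 0) (by
    rintro _ ⟨s, -, rfl⟩
    exact (Q.P s).map_cstarMatrix_nonneg') isClosed_completelyPositive (hT 0)
  let E : Op H →CP Op H := ⟨T, hcp⟩
  have hET : ∀ X, E X = T X := fun _ => rfl
  have hid : ∀ X, T (T X) = T X := fun X => DFunLike.congr_fun hTT X
  -- properties of all `P_s`, `s ≥ t`, that are closed conditions pass to `T`
  have hstar : ∀ X, T (star X) = star (T X) := fun X => map_star E X
  have hcomp : ∀ X, tr (σ * T X) = tr (σ * X) := fun X => by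
    refine closure_minimal (s := Q.tail 0) (t := {S | tr (σ * S X) = tr (σ * X)}) ?_
      (isClosed_eq (Continuous.opTr (by fun_prop)) continuous_const) (hT 0)
    rintro _ ⟨s, -, rfl⟩
    exact hσ.2 s X
  have hnorm : ∀ t X, ‖T X‖ ≤ ‖Q.P t X‖ := fun t X => by
    refine closure_minimal (s := Q.tail t) (t := {S | ‖S X‖ ≤ ‖Q.P t X‖}) ?_
      (isClosed_le (by fun_prop) continuous_const) (hT t)
    rintro _ ⟨s, hs, rfl⟩
    obtain ⟨r, rfl⟩ := exists_add_of_le (Set.mem_Ici.mp hs)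
    rw [Set.mem_ofPred_eq, Pc_apply, add_comm]
    exact Q.norm_P_add_le r t X
  have hker : ∀ X, T X = 0 ↔ Tendsto (fun t : ℝ≥0 => Q.P t X) atTop (𝓝 0) := by
    intro X
    constructor
    · intro h0
      rw [Metric.tendsto_atTop]
      intro ε hε
      have hc : Continuous fun S : Op H →L[ℂ] Op H => ‖S X‖ := by fun_prop
      have hlt : T ∈ {S : Op H →L[ℂ] Op H | ‖S X‖ < ε} := by
        simpa [h0] using hε
      obtain ⟨_, hS, ⟨s, -, rfl⟩⟩ := mem_closure_iff.mp (hT 0) _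
        (isOpen_lt hc continuous_const) hlt
      refine ⟨s, fun t ht => ?_⟩
      obtain ⟨r, rfl⟩ := exists_add_of_le ht
      rw [dist_zero_right, add_comm]
      exact (Q.norm_P_add_le r s X).trans_lt hS
    · intro h
      have h1 := h.norm
      rw [norm_zero] at h1
      exact norm_le_zero_iff.mp (ge_of_tendsto h1 (Eventually.of_forall fun t => hnorm t X))
  -- for a fixed point `X` of `T` the quantity `σ(P_t(X)* P_t(X))` cannot decrease,
  -- so that equality holds in the Kadison–Schwarz inequality
  have hfix : ∀ X, T X = X → ∀ t, Q.P t (star X * X) = star (Q.P t X) * Q.P t X := by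
    intro X hX t
    refine (eq_of_tr_mul_eq hσf (kadison_schwarz _ (Q.map_one t) X) ?_).symm
    rw [hσ.2]
    have h1 : tr (σ * (star (T X) * T X)) ≤ tr (σ * (star (Q.P t X) * Q.P t X)) := by
      refine closure_minimal (s := Q.tail t)
        (t := {S | tr (σ * (star (S X) * S X)) ≤ tr (σ * (star (Q.P t X) * Q.P t X))}) ?_
        (isClosed_le (Continuous.opTr (by fun_prop)) continuous_const) (hT t)
      rintro _ ⟨s, hs, rfl⟩
      obtain ⟨r, rfl⟩ := exists_add_of_le (Set.mem_Ici.mp hs)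
      rw [Set.mem_ofPred_eq, Pc_apply, add_comm, Q.add]
      refine (tr_mul_mono hσf.nonneg (kadison_schwarz _ (Q.map_one r) _)).trans_eq ?_
      rw [hσ.2]
    rwa [hX] at h1
  have hmem : ∀ X, T X = X → X ∈ Q.dfStarSubalgebra := fun X hX =>
    Q.mem_df_of_eq (hfix X hX) fun t => by
      simpa [P_star] using hfix (star X) (by rw [hstar, hX]) t
  refine ⟨E, fun X => hid X, fun X => hcomp X, ?_, fun X => hker X⟩
  ext X
  constructor
  · rintro ⟨Y, rfl⟩
    exact hmem _ (hid Y)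
  · intro hX
    refine ⟨X, ?_⟩
    rw [hET, eq_comm, ← sub_eq_zero]
    have hY : X - T X ∈ Q.dfStarSubalgebra := sub_mem hX (hmem _ (hid X))
    have h0 : T (X - T X) = 0 := by rw [map_sub, hid, sub_self]
    have ht := (hker _).mp h0
    generalize X - T X = Y at hY ht
    refine CStarRing.star_mul_self_eq_zero_iff Y |>.mp
      (eq_zero_of_tr_mul_eq_zero hσf (star_mul_self_nonneg Y) ?_)
    have hlim : Tendsto (fun t => tr (σ * (star (Q.P t Y) * Q.P t Y))) atTop
        (𝓝 (tr (σ * (star (0 : Op H) * 0)))) := by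
      have hc : Continuous fun Z : Op H => tr (σ * (star Z * Z)) :=
        Continuous.opTr (by fun_prop)
      exact (hc.tendsto 0).comp ht
    have hconst : (fun t => tr (σ * (star (Q.P t Y) * Q.P t Y)))
        = fun _ => tr (σ * (star Y * Y)) := by
      funext t
      rw [← (hY t Y).1, hσ.2]
    rw [hconst] at hlim
    simpa using tendsto_nhds_unique tendsto_const_nhds hlim

end QMS

end

/-! ### Functional calculus in finite dimension and relative entropies of products -/

section

section FunctionalCalculus

open Polynomial

variable {H : Type*} [NormedAddCommGroup H] [InnerProductSpace ℂ H] [CompleteSpace H]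
  [FiniteDimensional ℂ H]

omit [CompleteSpace H] in
theorem finite_spectrum (a : Op H) : (spectrum ℝ a).Finite := by
  have hfin : FiniteDimensional ℝ (Op H) := Module.Finite.trans (R := ℝ) ℂ (Op H)
  rcases subsingleton_or_nontrivial (Op H) with hs | hn
  · simp [spectrum.of_subsingleton]
  have hint : IsIntegral ℝ a := Algebra.IsIntegral.isIntegral a
  refine ((minpoly ℝ a).rootSet_finite ℝ).subset fun x hx => ?_
  have h := spectrum.subset_polynomial_aeval a (minpoly ℝ a) ⟨x, hx, rfl⟩
  rw [minpoly.aeval, spectrum.zero_eq, Set.mem_singleton_iff] at h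
  rw [mem_rootSet]
  exact ⟨minpoly.ne_zero hint, by simpa [aeval_def] using h⟩

omit [CompleteSpace H] in
theorem continuousOn_spectrum (f : ℝ → ℝ) (a : Op H) : ContinuousOn f (spectrum ℝ a) :=
  (finite_spectrum a).continuousOn f

/-- In finite dimension every function of an operator is a polynomial, and the same polynomial
can be used for two operators. -/
theorem exists_cfc_eq_aeval (f : ℝ → ℝ) {a b : Op H} (ha : IsSelfAdjoint a)
    (hb : IsSelfAdjoint b) : ∃ q : ℝ[X], cfc f a = aeval a q ∧ cfc f b = aeval b q := by
  classical
  let s := (finite_spectrum a).toFinset ∪ (finite_spectrum b).toFinset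
  let q := Lagrange.interpolate s id f
  have hq : ∀ x ∈ s, f x = q.eval x := fun x hx =>
    (Lagrange.eval_interpolate_at_node f (Set.injOn_id _) hx).symm
  refine ⟨q, ?_, ?_⟩
  · rw [← cfc_polynomial q a ha]
    exact cfc_congr fun x hx => hq x (by simp [s, hx])
  · rw [← cfc_polynomial q b hb]
    exact cfc_congr fun x hx => hq x (by simp [s, hx])

omit [FiniteDimensional ℂ H] in
theorem aeval_mem {N : StarSubalgebra ℂ (Op H)} {a : Op H} (ha : a ∈ N) (q : ℝ[X]) :
    aeval a q ∈ N := by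
  rw [aeval_eq_sum_range]
  refine sum_mem fun i _ => ?_
  rw [← Complex.coe_smul]
  exact SMulMemClass.smul_mem _ (pow_mem ha i)

theorem cfc_mem {N : StarSubalgebra ℂ (Op H)} {a : Op H} (ha : a ∈ N) (f : ℝ → ℝ) :
    cfc f a ∈ N := by
  by_cases hs : IsSelfAdjoint a
  · obtain ⟨q, hq, -⟩ := exists_cfc_eq_aeval f hs hs
    rw [hq]
    exact aeval_mem ha q
  · rw [cfc_apply_of_not_predicate a hs]
    exact zero_mem N

/-- Operators that agree on the range of `p` have functions that agree there. -/
theorem cfc_mul_eq_cfc_mul (f : ℝ → ℝ) {a b p : Op H} (ha : IsSelfAdjoint a)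
    (hb : IsSelfAdjoint b) (hpb : Commute p b) (h : a * p = b * p) :
    cfc f a * p = cfc f b * p := by
  obtain ⟨q, hqa, hqb⟩ := exists_cfc_eq_aeval f ha hb
  have hpow : ∀ n, a ^ n * p = b ^ n * p := by
    intro n
    induction n with
    | zero => simp
    | succ n ih =>
      rw [pow_succ, mul_assoc, h, ← hpb.eq, ← mul_assoc, ih, mul_assoc, hpb.eq, ← mul_assoc,
        ← pow_succ]
  rw [hqa, hqb, aeval_eq_sum_range, aeval_eq_sum_range, Finset.sum_mul, Finset.sum_mul]
  refine Finset.sum_congr rfl fun i _ => ?_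
  rw [smul_mul_assoc, hpow, smul_mul_assoc]

/-- The spectral decomposition of a function of an operator. -/
theorem cfc_eq_sum_spectral (f : ℝ → ℝ) (a : Op H) : cfc f a =
    ∑ x ∈ (finite_spectrum a).toFinset, f x • cfc (Set.indicator {x} 1 : ℝ → ℝ) a := by
  simp_rw [← cfc_smul _ _ a (continuousOn_spectrum _ a)]
  rw [← cfc_sum _ _ _ fun _ _ => continuousOn_spectrum _ a]
  refine cfc_congr fun x hx => ?_
  rw [Finset.sum_apply, Finset.sum_eq_single x]
  · simp
  · intro y _ hy
    simp [Set.indicator_of_notMem (Set.mem_singleton_iff.not.mpr hy.symm)]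
  · intro h
    exact absurd ((finite_spectrum a).mem_toFinset.mpr hx) h

theorem isIdempotentElem_cfc_indicator (s : Set ℝ) (a : Op H) :
    IsIdempotentElem (cfc (Set.indicator s 1 : ℝ → ℝ) a) := by
  rw [IsIdempotentElem, ← cfc_mul _ _ a (continuousOn_spectrum _ a) (continuousOn_spectrum _ a)]
  refine cfc_congr fun x _ => ?_
  by_cases hx : x ∈ s <;> simp [hx]

omit [FiniteDimensional ℂ H] in
/-- The logarithm of a product of commuting strictly positive operators. -/
theorem log_mul_of_commute {a b : Op H} (ha : IsStrictlyPositive a) (hb : IsStrictlyPositive b)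
    (h : Commute a b) : CFC.log (a * b) = CFC.log a + CFC.log b := by
  have hc : Commute (CFC.log a) (CFC.log b) := by
    have h1 : Commute (CFC.log a) b :=
      IsSelfAdjoint.commute_cfc ha.isSelfAdjoint h _
    exact (IsSelfAdjoint.commute_cfc hb.isSelfAdjoint h1.symm _).symm
  have he : NormedSpace.exp (CFC.log a + CFC.log b) = a * b := by
    let _ : NormedAlgebra ℚ (Op H) := .restrictScalars ℚ ℂ (Op H)
    rw [NormedSpace.exp_add_of_commute hc, CFC.exp_log a ha, CFC.exp_log b hb]
  rw [← he, CFC.log_exp _ (IsSelfAdjoint.log.add IsSelfAdjoint.log)]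

end FunctionalCalculus

section Faithful

variable {H : Type*} [NormedAddCommGroup H] [InnerProductSpace ℂ H] [CompleteSpace H]
  [FiniteDimensional ℂ H]

theorem isStrictlyPositive_of_injective {A : Op H} (hA : 0 ≤ A) (h : ∀ v, A v = 0 → v = 0) :
    IsStrictlyPositive A := by
  refine IsUnit.isStrictlyPositive ?_ hA
  rw [ContinuousLinearMap.isUnit_iff_bijective]
  have hi : Function.Injective (A : H →ₗ[ℂ] H) := by
    rw [← LinearMap.ker_eq_bot, LinearMap.ker_eq_bot']
    exact h
  exact ⟨hi, LinearMap.injective_iff_surjective.mp hi⟩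

/-- A positive operator is strictly positive as soon as its trace pairing is faithful. -/
theorem isStrictlyPositive_of_tr_mul {A : Op H} (hA : 0 ≤ A)
    (h : ∀ B : Op H, 0 ≤ B → tr (A * B) = 0 → B = 0) : IsStrictlyPositive A := by
  refine isStrictlyPositive_of_injective hA fun v hv => ?_
  have h1 := h (InnerProductSpace.rankOne ℂ v v)
    ((ContinuousLinearMap.nonneg_iff_isPositive _).mpr
      (InnerProductSpace.isPositive_rankOne_self v)) (by
    have h2 : A * InnerProductSpace.rankOne ℂ v v = 0 := by ext w; simp [hv]
    rw [h2, map_zero])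
  have h3 := congrArg tr h1
  rw [map_zero, tr_apply, InnerProductSpace.trace_rankOne] at h3
  simpa using h3

omit [FiniteDimensional ℂ H] in
theorem injective_of_isStrictlyPositive {A : Op H} (hA : IsStrictlyPositive A) {v : H}
    (hv : A v = 0) : v = 0 := by
  have := (ContinuousLinearMap.isUnit_iff_bijective.mp hA.isUnit).1
  exact this (by rw [hv, map_zero])

end Faithful

section Density

variable {H : Type*} [NormedAddCommGroup H] [InnerProductSpace ℂ H] [CompleteSpace H]
  [FiniteDimensional ℂ H]

/-- The trace pairing is nondegenerate on a star subalgebra `N`, so that the functional `Tr[ρ ·]` on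
`N` is represented by some `h ∈ N`, the *density of `ρ` on `N`*. -/
theorem exists_density (N : StarSubalgebra ℂ (Op H)) (ρ : Op H) :
    ∃ h ∈ N, ∀ Y ∈ N, tr (ρ * Y) = tr (h * Y) := by
  let V : Submodule ℂ (Op H) := Subalgebra.toSubmodule N.toSubalgebra
  let Φ : V →ₗ[ℂ] Module.Dual ℂ V := (trForm.domRestrict₁₂ V V)
  have hΦ : ∀ x y : V, Φ x y = tr ((x : Op H) * (y : Op H)) := fun _ _ => rfl
  have hinj : Function.Injective Φ := by
    rw [← LinearMap.ker_eq_bot, LinearMap.ker_eq_bot']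
    intro x hx
    have h := DFunLike.congr_fun hx ⟨star (x : Op H), star_mem (s := N) x.2⟩
    rw [hΦ, LinearMap.zero_apply, tr_mul_comm] at h
    exact Subtype.ext (eq_zero_of_tr_star_mul_self h)
  have hsurj : Function.Surjective Φ :=
    (LinearMap.injective_iff_surjective_of_finrank_eq_finrank
      Subspace.dual_finrank_eq.symm).mp hinj
  obtain ⟨x, hx⟩ := hsurj ((trForm ρ).domRestrict V)
  refine ⟨x, x.2, fun Y hY => ?_⟩
  exact (DFunLike.congr_fun hx ⟨Y, hY⟩).symm

/-- Densities on a star subalgebra are unique. -/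
theorem density_unique {N : StarSubalgebra ℂ (Op H)} {h k : Op H} (hh : h ∈ N) (hk : k ∈ N)
    (e : ∀ Y ∈ N, tr (h * Y) = tr (k * Y)) : h = k := by
  rw [← sub_eq_zero]
  refine eq_zero_of_tr_star_mul_self ?_
  rw [tr_mul_comm, sub_mul, map_sub, e _ (star_mem (sub_mem hh hk)), sub_self]

/-- The entropy formula behind the conditional expectation: if `h` is the density of `ρ` on `N` and
`κ > 0` commutes with `N`, then `ρ` is supported in the support of `h κ`, the logarithm of `h κ`
splits inside `Tr[ρ ·]`, and `Tr[ρ log h] = Tr[h log h]` because `log h ∈ N`. -/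
theorem relEntropy_mul {N : StarSubalgebra ℂ (Op H)} {ρ h κ : Op H} (hρ : 0 ≤ ρ) (hh : 0 ≤ h)
    (hN : h ∈ N) (hd : ∀ Y ∈ N, tr (ρ * Y) = tr (h * Y)) (hκ : IsStrictlyPositive κ)
    (hcomm : ∀ Y ∈ N, Commute Y κ) :
    relEntropy ρ (h * κ) = (((tr (ρ * CFC.log ρ)).re - (tr (h * CFC.log h)).re
      - (tr (ρ * CFC.log κ)).re : ℝ) : EReal) := by
  classical
  -- the support projection of `h`, and `h` with the eigenvalue `0` replaced by `1`
  set p : Op H := cfc (Set.indicator {0}ᶜ 1 : ℝ → ℝ) h with hp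
  set h' : Op H := cfc (fun x : ℝ => if x = 0 then 1 else x) h with hh'
  have hsa : IsSelfAdjoint h := hh.isSelfAdjoint
  have hpN : p ∈ N := cfc_mem hN _
  have hh'N : h' ∈ N := cfc_mem hN _
  have hpsa : IsSelfAdjoint p := cfc_predicate _ h
  have hpp : p * p = p := isIdempotentElem_cfc_indicator _ h
  have hph : h * p = h := by
    conv_lhs => rw [← cfc_id ℝ h]
    conv_rhs => rw [← cfc_id ℝ h]
    rw [hp, ← cfc_mul _ _ h (continuousOn_spectrum _ h) (continuousOn_spectrum _ h)]
    refine cfc_congr fun x _ => ?_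
    by_cases hx : x = 0 <;> simp [hx]
  have hph' : h * p = h' * p := by
    conv_lhs => rw [← cfc_id ℝ h]
    rw [hp, hh', ← cfc_mul _ _ h (continuousOn_spectrum _ h) (continuousOn_spectrum _ h),
      ← cfc_mul _ _ h (continuousOn_spectrum _ h) (continuousOn_spectrum _ h)]
    refine cfc_congr fun x _ => ?_
    by_cases hx : x = 0 <;> simp [hx]
  have hh'pos : IsStrictlyPositive h' := by
    rw [hh', cfc_isStrictlyPositive_iff _ h (continuousOn_spectrum _ h)]
    intro x hx
    have : 0 ≤ x := spectrum_nonneg_of_nonneg hh hx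
    by_cases h0 : x = 0
    · simp [h0]
    · simpa [h0] using lt_of_le_of_ne this (Ne.symm h0)
  have hph'c : Commute p h' := cfc_commute_cfc _ _ h
  -- `Tr[ρ (1 - p)] = Tr[h (1 - p)] = 0` since `1 - p ∈ N`
  have hρp : ρ * p = ρ := by
    have h1 : ρ * (1 - p) = 0 := by
      refine mul_eq_zero_of_tr_mul_eq_zero hρ ?_ ?_
      · have : (1 - p) = star (1 - p) * (1 - p) := by
          rw [star_sub, star_one, hpsa.star_eq, mul_sub, sub_mul, sub_mul, hpp]
          simp
        rw [this]
        exact star_mul_self_nonneg _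
      · rw [hd _ (sub_mem (one_mem N) hpN), mul_sub, mul_one, hph, sub_self, map_zero]
    rw [mul_sub, mul_one, sub_eq_zero] at h1
    exact h1.symm
  have hpρ : p * ρ = ρ := by
    have := congrArg star hρp
    rwa [star_mul, hpsa.star_eq, hρ.isSelfAdjoint.star_eq] at this
  have hpκ : Commute p κ := hcomm p hpN
  have hsup : supp ρ ≤ supp (h * κ) := by
    refine Submodule.orthogonal_le fun v hv => ?_
    have hv' : (h * κ) v = 0 := hv
    rw [(hcomm h hN).eq] at hv'
    have hv0 : h v = 0 := injective_of_isStrictlyPositive hκ hv'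
    have hpv : p v = 0 := by
      have : p = cfc (fun x : ℝ => x⁻¹) h * h := by
        conv_rhs => enter [2]; rw [← cfc_id ℝ h]
        rw [hp, ← cfc_mul _ _ h (continuousOn_spectrum _ h) (continuousOn_spectrum _ h)]
        refine cfc_congr fun x _ => ?_
        by_cases hx : x = 0 <;> simp [hx]
      rw [this]
      change (cfc (fun x : ℝ => x⁻¹) h) (h v) = 0
      rw [hv0, map_zero]
    change ρ v = 0
    rw [← hρp]
    change ρ (p v) = 0
    rw [hpv, map_zero]
  -- on the range of `p` the singular operator `h κ` agrees with the invertible one `h' κ`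
  have hlog : CFC.log (h * κ) * p = (CFC.log h' + CFC.log κ) * p := by
    rw [← log_mul_of_commute hh'pos hκ (hcomm _ hh'N)]
    refine cfc_mul_eq_cfc_mul _ ?_ ?_ (hph'c.mul_right hpκ) ?_
    · exact (hsa.commute_iff hκ.isSelfAdjoint).mp (hcomm h hN)
    · exact (hh'pos.isSelfAdjoint.commute_iff hκ.isSelfAdjoint).mp (hcomm _ hh'N)
    · rw [mul_assoc, ← hpκ.eq, ← mul_assoc, hph', mul_assoc, hpκ.eq, mul_assoc]
  have hlogh : CFC.log h' * p = CFC.log h * p :=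
    (cfc_mul_eq_cfc_mul _ hsa hh'pos.isSelfAdjoint hph'c hph').symm
  have hlogN : ∀ k ∈ N, CFC.log k ∈ N := fun k hk => cfc_mem hk _
  have cyc : ∀ A B : Op H, p * A = A → tr (A * B) = tr (A * (B * p)) := fun A B hA => by
    conv_lhs => rw [← hA, mul_assoc, tr_mul_comm, mul_assoc]
  have hp_h : p * h = h := by
    have := congrArg star hph
    rwa [star_mul, hpsa.star_eq, hsa.star_eq] at this
  have e1 : tr (ρ * CFC.log (h * κ)) = tr (h * CFC.log h) + tr (ρ * CFC.log κ) := by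
    rw [cyc _ _ hpρ, hlog, ← cyc _ _ hpρ, mul_add, map_add, hd _ (hlogN _ hh'N), cyc _ _ hp_h,
      hlogh, ← cyc _ _ hp_h]
  rw [relEntropy, if_pos hsup, mul_sub, map_sub, e1]
  congr 1
  simp only [Complex.sub_re, Complex.add_re]
  ring

end Density

end

/-! ### Dynamics on the decoherence-free algebra and the entropy formula -/

section

variable {H : Type*} [NormedAddCommGroup H] [InnerProductSpace ℂ H] [CompleteSpace H]
  [FiniteDimensional ℂ H]

namespace QMS

variable (Q : QMS H)

omit [FiniteDimensional ℂ H] in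
open Polynomial in
theorem P_aeval {X : Op H} (hX : X ∈ Q.dfStarSubalgebra) (t : ℝ≥0) (q : ℝ[X]) :
    Q.P t (aeval X q) = aeval (Q.P t X) q := by
  have hpow : ∀ n, Q.P t (X ^ n) = Q.P t X ^ n := by
    intro n
    induction n with
    | zero => simp [Q.map_one]
    | succ n ih => rw [pow_succ', pow_succ', Q.P_mul_of_mem_left hX, ih]
  rw [aeval_eq_sum_range, aeval_eq_sum_range, map_sum]
  refine Finset.sum_congr rfl fun i _ => ?_
  rw [← Complex.coe_smul, map_smul, hpow, Complex.coe_smul]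

theorem P_cfc {X : Op H} (hX : X ∈ Q.dfStarSubalgebra) (hs : IsSelfAdjoint X) (t : ℝ≥0)
    (f : ℝ → ℝ) : Q.P t (cfc f X) = cfc f (Q.P t X) := by
  have hs' : IsSelfAdjoint (Q.P t X) := by rw [IsSelfAdjoint, ← P_star, hs.star_eq]
  obtain ⟨q, h1, h2⟩ := exists_cfc_eq_aeval f hs hs'
  rw [h1, h2, Q.P_aeval hX]

/-- The trace of an idempotent of the decoherence-free algebra is an integer depending continuously
on time, hence it is conserved. -/
theorem tr_P_of_isIdempotentElem {p : Op H} (hp : p ∈ Q.dfStarSubalgebra)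
    (hpp : IsIdempotentElem p) (t : ℝ≥0) : tr (Q.P t p) = tr p := by
  have hint : ∀ s, tr (Q.P s p) ∈ Set.range ((↑) : ℕ → ℂ) := fun s => by
    have h1 : Q.P s p * Q.P s p = Q.P s p := by rw [← Q.P_mul_of_mem_left hp, hpp.eq]
    have h2 : IsIdempotentElem ((Q.P s p : Op H) : H →ₗ[ℂ] H) :=
      congrArg (fun A : Op H => (A : H →ₗ[ℂ] H)) h1
    refine ⟨Module.finrank ℂ (LinearMap.range ((Q.P s p : Op H) : H →ₗ[ℂ] H)), ?_⟩
    rw [tr_apply, (LinearMap.IsIdempotentElem.isProj_range _ h2).trace]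
  have hd : IsDiscrete (Set.range ((↑) : ℕ → ℂ)) :=
    (Complex.isUniformEmbedding_ofReal.isEmbedding.comp
      Nat.isClosedEmbedding_coe_real.isEmbedding).isInducing.isDiscrete_range
  obtain ⟨y, -, hy⟩ := isPreconnected_univ.eqOn_const_of_mapsTo hd
    (Q.continuous p).opTr.continuousOn (fun s _ => hint s) (Set.range_nonempty _)
  have e0 : tr (Q.P 0 p) = y := hy (Set.mem_univ 0)
  have e1 : tr (Q.P t p) = y := hy (Set.mem_univ t)
  rw [Q.zero] at e0
  exact e1.trans e0.symm

theorem tr_P_of_mem {X : Op H} (hX : X ∈ Q.dfStarSubalgebra) (t : ℝ≥0) :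
    tr (Q.P t X) = tr X := by
  have hsa : ∀ Y ∈ Q.dfStarSubalgebra, IsSelfAdjoint Y → tr (Q.P t Y) = tr Y := by
    intro Y hY hs
    conv_lhs => rw [← cfc_id ℝ Y, cfc_eq_sum_spectral]
    conv_rhs => rw [← cfc_id ℝ Y, cfc_eq_sum_spectral]
    simp only [map_sum, ← Complex.coe_smul, map_smul]
    refine Finset.sum_congr rfl fun x _ => ?_
    rw [Q.tr_P_of_isIdempotentElem (cfc_mem hY _) (isIdempotentElem_cfc_indicator _ _)]
  have hre : (realPart X : Op H) ∈ Q.dfStarSubalgebra := by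
    rw [realPart_apply_coe, ← Complex.coe_smul]
    exact SMulMemClass.smul_mem _ (add_mem hX (star_mem hX))
  have him : (imaginaryPart X : Op H) ∈ Q.dfStarSubalgebra := by
    rw [imaginaryPart_apply_coe, ← Complex.coe_smul]
    exact SMulMemClass.smul_mem _ (SMulMemClass.smul_mem _ (sub_mem hX (star_mem hX)))
  rw [← realPart_add_I_smul_imaginaryPart X]
  simp only [map_add, map_smul]
  rw [hsa _ hre (realPart X).2, hsa _ him (imaginaryPart X).2]

variable {Q} {σ : Op H}

/-- `P_t` maps the decoherence-free algebra onto itself: it is isometric there for the norm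
`σ(X* X)`, and the dimension is finite. -/
theorem exists_mem_P_eq (hσ : Q.IsInvariantState σ) (hσf : IsStrictlyPositive σ) (t : ℝ≥0)
    {X : Op H} (hX : X ∈ Q.dfStarSubalgebra) : ∃ Z ∈ Q.dfStarSubalgebra, Q.P t Z = X := by
  let V : Submodule ℂ (Op H) := Subalgebra.toSubmodule Q.dfStarSubalgebra.toSubalgebra
  let Φ : V →ₗ[ℂ] V := (Q.P t).toLinearMap.restrict fun Y hY => Q.P_mem hY t
  have hinj : Function.Injective Φ := by
    rw [← LinearMap.ker_eq_bot, LinearMap.ker_eq_bot']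
    intro Y hY
    have hY0 : Q.P t (Y : Op H) = 0 := congrArg Subtype.val hY
    have hY1 := (show (Y : Op H) ∈ Q.dfStarSubalgebra from Y.2) t Y
    have h2 : tr (σ * (star (Y : Op H) * (Y : Op H))) = 0 := by
      rw [← hσ.2 t, hY1.1, hY0]
      simp
    exact Subtype.ext ((CStarRing.star_mul_self_eq_zero_iff _).mp
      (eq_zero_of_tr_mul_eq_zero hσf (star_mul_self_nonneg _) h2))
  obtain ⟨Z, hZ⟩ := LinearMap.injective_iff_surjective.mp hinj ⟨X, hX⟩
  exact ⟨Z, Z.2, congrArg Subtype.val hZ⟩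

theorem tr_dual_mul (t : ℝ≥0) (ρ X : Op H) : tr (Q.dual t ρ * X) = tr (ρ * Q.P t X) := by
  rw [tr_mul_comm, dual, ← predual_spec, tr_mul_comm]
  rfl

omit [FiniteDimensional ℂ H] in
theorem P_nonneg (t : ℝ≥0) {X : Op H} (hX : 0 ≤ X) : 0 ≤ Q.P t X := map_nonneg (Q.P t) hX

theorem dual_nonneg (t : ℝ≥0) {ρ : Op H} (hρ : 0 ≤ ρ) : 0 ≤ Q.dual t ρ :=
  nonneg_of_tr_mul_nonneg fun B hB => by
    rw [tr_dual_mul]; exact tr_mul_nonneg hρ (P_nonneg t hB)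

theorem tr_dual (t : ℝ≥0) (ρ : Op H) : tr (Q.dual t ρ) = tr ρ := by
  simpa [Q.map_one] using tr_dual_mul (Q := Q) t ρ 1

theorem isState_dual (t : ℝ≥0) {ρ : Op H} (hρ : IsState ρ) : IsState (Q.dual t ρ) :=
  ⟨dual_nonneg t hρ.1, (tr_dual t ρ).trans hρ.2⟩

theorem dual_isStrictlyPositive (hσ : Q.IsInvariantState σ) (hσf : IsStrictlyPositive σ)
    (t : ℝ≥0) {ρ : Op H} (hρ : IsStrictlyPositive ρ) : IsStrictlyPositive (Q.dual t ρ) := by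
  refine isStrictlyPositive_of_tr_mul (dual_nonneg t hρ.nonneg) fun B hB h => ?_
  rw [tr_dual_mul] at h
  have h1 := eq_zero_of_tr_mul_eq_zero hρ (P_nonneg t hB) h
  refine eq_zero_of_tr_mul_eq_zero hσf hB ?_
  rw [← hσ.2 t, h1, mul_zero, map_zero]

theorem dual_zero (ρ : Op H) : Q.dual 0 ρ = ρ :=
  eq_of_tr_mul_eq_tr_mul fun Y => by rw [tr_dual_mul, Q.zero]

theorem dual_add (s t : ℝ≥0) (ρ : Op H) : Q.dual (s + t) ρ = Q.dual s (Q.dual t ρ) :=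
  eq_of_tr_mul_eq_tr_mul fun Y => by
    rw [tr_dual_mul, tr_dual_mul, tr_dual_mul, add_comm, Q.add]

/-- On the decoherence-free algebra the semigroup acts by trace-preserving automorphisms, so that
the entropy of the decoherence-free part of a state is conserved. -/
theorem tr_mul_log_density_eq (hσ : Q.IsInvariantState σ) (hσf : IsStrictlyPositive σ) (t : ℝ≥0)
    {ρ h k : Op H} (hh : h ∈ Q.dfStarSubalgebra) (hk : k ∈ Q.dfStarSubalgebra) (hk0 : 0 ≤ k)
    (hd : ∀ Y ∈ Q.dfStarSubalgebra, tr (ρ * Y) = tr (h * Y))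
    (kd : ∀ Y ∈ Q.dfStarSubalgebra, tr (Q.dual t ρ * Y) = tr (k * Y)) :
    tr (h * CFC.log h) = tr (k * CFC.log k) := by
  -- `P_t` moves the density at time `t` back to the initial one
  have e : h = Q.P t k := by
    refine density_unique hh (Q.P_mem hk t) fun Y hY => ?_
    obtain ⟨Z, hZ, rfl⟩ := exists_mem_P_eq hσ hσf t hY
    rw [← hd _ hY, ← tr_dual_mul, kd _ hZ, ← Q.P_mul_of_mem_left hk,
      Q.tr_P_of_mem (mul_mem hk hZ)]
  rw [e, CFC.log, ← Q.P_cfc hk hk0.isSelfAdjoint, ← Q.P_mul_of_mem_left hk,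
    Q.tr_P_of_mem (mul_mem hk (cfc_mem hk _))]
  rfl

section Expectation

theorem exists_dfExpectation_eq (hσ : Q.IsInvariantState σ) (hσf : IsStrictlyPositive σ) :
    ∃ E, Q.IsDFExpectation σ E ∧ Q.dfExpectation σ = E.toLinearMap := by
  have h := Q.exists_isDFExpectation hσ hσf
  exact ⟨h.choose, h.choose_spec, dif_pos h⟩

omit [FiniteDimensional ℂ H] in
theorem IsDFExpectation.map_of_mem {E : Op H →CP Op H} (hE : Q.IsDFExpectation σ E) {X : Op H}
    (hX : X ∈ Q.dfStarSubalgebra) : E X = X := by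
  have h : X ∈ Set.range E := by rw [hE.range_eq]; exact hX
  obtain ⟨Y, rfl⟩ := h
  exact hE.idem Y

omit [FiniteDimensional ℂ H] in
theorem IsDFExpectation.map_mem {E : Op H →CP Op H} (hE : Q.IsDFExpectation σ E) (X : Op H) :
    E X ∈ Q.dfStarSubalgebra := by
  have h : E X ∈ Set.range E := ⟨X, rfl⟩
  rw [hE.range_eq] at h
  exact h

omit [FiniteDimensional ℂ H] in
/-- The bimodule property of the conditional expectation, since the decoherence-free algebra lies in
its multiplicative domain. -/
theorem IsDFExpectation.map_mul_left {E : Op H →CP Op H} (hE : Q.IsDFExpectation σ E) {X : Op H}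
    (hX : X ∈ Q.dfStarSubalgebra) (Y : Op H) : E (X * Y) = X * E Y := by
  have h := map_star_mul_of_eq E (hE.map_of_mem (one_mem _)) (b := star X) (by
    rw [hE.map_of_mem (star_mem hX), star_star, hE.map_of_mem (mul_mem hX (star_mem hX))]) Y
  rwa [star_star, hE.map_of_mem (star_mem hX), star_star] at h

omit [FiniteDimensional ℂ H] in
theorem IsDFExpectation.map_mul_right {E : Op H →CP Op H} (hE : Q.IsDFExpectation σ E) {X : Op H}
    (hX : X ∈ Q.dfStarSubalgebra) (Y : Op H) : E (Y * X) = E Y * X := by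
  have h := map_mul_star_of_eq E (hE.map_of_mem (one_mem _)) (b := star X) (by
    rw [hE.map_of_mem (star_mem hX), star_star, hE.map_of_mem (mul_mem (star_mem hX) hX)]) Y
  rwa [star_star, hE.map_of_mem (star_mem hX), star_star] at h

theorem tr_dfDual_mul {E : Op H →CP Op H} (hE : Q.dfExpectation σ = E.toLinearMap)
    (ρ X : Op H) : tr (Q.dfDual σ ρ * X) = tr (ρ * E X) := by
  rw [tr_mul_comm, dfDual, ← predual_spec, tr_mul_comm, hE]
  rfl

theorem dfDual_one_isStrictlyPositive (hσ : Q.IsInvariantState σ) (hσf : IsStrictlyPositive σ) :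
    IsStrictlyPositive (Q.dfDual σ 1) := by
  obtain ⟨E, hE, hEq⟩ := exists_dfExpectation_eq hσ hσf
  have hpos : ∀ B : Op H, 0 ≤ B → 0 ≤ E B := fun B hB => map_nonneg E hB
  refine isStrictlyPositive_of_tr_mul (nonneg_of_tr_mul_nonneg fun B hB => ?_) fun B hB h => ?_
  · rw [tr_dfDual_mul hEq]
    exact tr_mul_nonneg zero_le_one (hpos B hB)
  · rw [tr_dfDual_mul hEq] at h
    have h1 := eq_zero_of_tr_mul_eq_zero isStrictlyPositive_one (hpos B hB) h
    refine eq_zero_of_tr_mul_eq_zero hσf hB ?_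
    rw [← hE.compatible, h1, mul_zero, map_zero]

/-- The functional `Tr[E_N(·)]` is tracial against the decoherence-free algebra, so its density
`E_{N*}(1)` commutes with that algebra. -/
theorem commute_dfDual_one (hσ : Q.IsInvariantState σ) (hσf : IsStrictlyPositive σ) {X : Op H}
    (hX : X ∈ Q.dfStarSubalgebra) : Commute X (Q.dfDual σ 1) := by
  obtain ⟨E, hE, hEq⟩ := exists_dfExpectation_eq hσ hσf
  refine eq_of_tr_mul_eq_tr_mul fun Y => ?_
  rw [mul_assoc, tr_mul_comm, mul_assoc, mul_assoc, tr_dfDual_mul hEq, tr_dfDual_mul hEq, one_mul,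
    one_mul, hE.map_mul_left hX, hE.map_mul_right hX, tr_mul_comm]

/-- `E_{N*}(ρ) = h E_{N*}(1)`, where `h` is the density of `ρ` on the decoherence-free algebra. -/
theorem dfDual_eq_mul (hσ : Q.IsInvariantState σ) (hσf : IsStrictlyPositive σ) {ρ h : Op H}
    (hh : h ∈ Q.dfStarSubalgebra)
    (hd : ∀ Y ∈ Q.dfStarSubalgebra, tr (ρ * Y) = tr (h * Y)) :
    Q.dfDual σ ρ = h * Q.dfDual σ 1 := by
  obtain ⟨E, hE, hEq⟩ := exists_dfExpectation_eq hσ hσf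
  refine eq_of_tr_mul_eq_tr_mul fun Y => ?_
  rw [(commute_dfDual_one hσ hσf hh).eq, mul_assoc, tr_dfDual_mul hEq, tr_dfDual_mul hEq, one_mul,
    hE.map_mul_left hh, hd _ (hE.map_mem Y)]

/-- The density of a positive operator is positive: `h` is the product of the commuting positive
operators `E_{N*}(ρ)` and `E_{N*}(1)⁻¹`. -/
theorem density_nonneg (hσ : Q.IsInvariantState σ) (hσf : IsStrictlyPositive σ) {ρ h : Op H}
    (hρ : 0 ≤ ρ) (hh : h ∈ Q.dfStarSubalgebra)
    (hd : ∀ Y ∈ Q.dfStarSubalgebra, tr (ρ * Y) = tr (h * Y)) : 0 ≤ h := by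
  obtain ⟨E, hE, hEq⟩ := exists_dfExpectation_eq hσ hσf
  have hκ := dfDual_one_isStrictlyPositive hσ hσf
  have hc := commute_dfDual_one hσ hσf hh
  have h1 : 0 ≤ h * Q.dfDual σ 1 := by
    rw [← dfDual_eq_mul hσ hσf hh hd]
    refine nonneg_of_tr_mul_nonneg fun B hB => ?_
    rw [tr_dfDual_mul hEq]
    exact tr_mul_nonneg hρ (map_nonneg E hB)
  have h2 : h = h * Q.dfDual σ 1 * Ring.inverse (Q.dfDual σ 1) := by
    rw [mul_assoc, Ring.mul_inverse_cancel _ hκ.isUnit, mul_one]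
  have h3 : Commute (h * Q.dfDual σ 1) (Ring.inverse (Q.dfDual σ 1)) := by
    rw [Ring.inverse_of_isUnit hκ.isUnit]
    exact Commute.units_inv_right (hc.mul_left (Commute.refl _))
  rw [h2]
  exact Commute.mul_nonneg h1 hκ.ringInverse.nonneg h3

theorem dfEntropy_eq (hσ : Q.IsInvariantState σ) (hσf : IsStrictlyPositive σ) {ρ h : Op H}
    (hρ : 0 ≤ ρ) (hh : h ∈ Q.dfStarSubalgebra)
    (hd : ∀ Y ∈ Q.dfStarSubalgebra, tr (ρ * Y) = tr (h * Y)) :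
    Q.dfEntropy σ ρ = (((tr (ρ * CFC.log ρ)).re - (tr (h * CFC.log h)).re
      - (tr (ρ * CFC.log (Q.dfDual σ 1))).re : ℝ) : EReal) := by
  rw [dfEntropy, dfDual_eq_mul hσ hσf hh hd]
  exact relEntropy_mul hρ (density_nonneg hσ hσf hρ hh hd) hh hd
    (dfDual_one_isStrictlyPositive hσ hσf) fun Y hY => commute_dfDual_one hσ hσf hY

end Expectation

end QMS

end

/-! ### Differentiability of the semigroup and Klein's inequality -/

section

section Semigroup

/-- A norm-continuous one-parameter semigroup in a Banach algebra is differentiable: averaging over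
a short time interval gives an invertible element, and the averaged semigroup is differentiable. -/
theorem exists_generator {𝔸 : Type*} [NormedRing 𝔸] [NormedAlgebra ℝ 𝔸] [CompleteSpace 𝔸]
    (T : ℝ≥0 → 𝔸) (hc : Continuous T) (h0 : T 0 = 1) (hadd : ∀ s t, T (s + t) = T s * T t) :
    ∃ G : 𝔸, ∀ t : ℝ, 0 ≤ t →
      HasDerivWithinAt (fun r : ℝ => T r.toNNReal) (T t.toNNReal * G) (Set.Ici 0) t := by
  set S : ℝ → 𝔸 := fun r => T r.toNNReal with hS
  have hSc : Continuous S := hc.comp continuous_real_toNNReal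
  have hS0 : S 0 = 1 := by simp [hS, h0]
  have hSadd : ∀ s t, 0 ≤ s → 0 ≤ t → S (s + t) = S s * S t := fun s t hs ht => by
    simp only [hS, Real.toNNReal_add hs ht, hadd]
  set J : ℝ → 𝔸 := fun t => ∫ s in (0 : ℝ)..t, S s with hJ
  have hJd : ∀ t, HasDerivAt J (S t) t := fun t =>
    intervalIntegral.integral_hasDerivAt_right (hSc.intervalIntegrable _ _)
      hSc.aestronglyMeasurable.stronglyMeasurableAtFilter hSc.continuousAt
  obtain ⟨δ, hδ, hu⟩ : ∃ δ : ℝ, 0 < δ ∧ IsUnit (J δ) := by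
    have h1 := (hasDerivAt_iff_tendsto_slope.mp (hJd 0)).mono_left
      (nhdsWithin_mono 0 (fun x (hx : x ∈ Set.Ioi 0) => ne_of_gt hx))
    rw [hS0] at h1
    have h2 := h1.eventually (Units.isOpen.mem_nhds (isUnit_one (M := 𝔸)))
    obtain ⟨δ, hδu, hδ⟩ := (h2.and self_mem_nhdsWithin).exists
    refine ⟨δ, hδ, ?_⟩
    have h3 : slope J 0 δ = δ⁻¹ • J δ := by simp [slope, hJ]
    have h4 : IsUnit (δ⁻¹ • J δ) := by rw [← h3]; exact hδu
    exact (isUnit_smul_iff (Units.mk0 δ⁻¹ (inv_ne_zero (ne_of_gt hδ))) (J δ)).mp h4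
  have key : ∀ t, 0 ≤ t → S t = (J (t + δ) - J t) * Ring.inverse (J δ) := by
    intro t ht
    have h1 : S t * J δ = J (t + δ) - J t := by
      simp only [hJ]
      rw [intervalIntegral.integral_interval_sub_left (hSc.intervalIntegrable _ _)
        (hSc.intervalIntegrable _ _)]
      have h2 : ∫ s in t..(t + δ), S s = ∫ s in (0 : ℝ)..δ, S (t + s) := by
        rw [intervalIntegral.integral_comp_add_left]
        simp
      have h3 := (ContinuousLinearMap.mul ℝ 𝔸 (S t)).intervalIntegral_comp_comm
        (hSc.intervalIntegrable (μ := MeasureTheory.volume) 0 δ)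
      rw [h2]
      refine h3.symm.trans ?_
      refine intervalIntegral.integral_congr fun s hs => ?_
      rw [Set.uIcc_of_le hδ.le] at hs
      exact (hSadd t s ht hs.1).symm
    rw [← h1, mul_assoc, Ring.mul_inverse_cancel _ hu, mul_one]
  refine ⟨(S δ - 1) * Ring.inverse (J δ), fun t ht => ?_⟩
  have hd : HasDerivAt (fun r => (J (r + δ) - J r) * Ring.inverse (J δ))
      ((S (t + δ) - S t) * Ring.inverse (J δ)) t :=
    (((hJd (t + δ)).comp_add_const t δ).sub (hJd t)).mul_const _
  have he : (S (t + δ) - S t) * Ring.inverse (J δ) = S t * ((S δ - 1) * Ring.inverse (J δ)) := by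
    rw [hSadd t δ ht hδ.le, ← mul_assoc, mul_sub, mul_one]
  rw [he] at hd
  exact hd.hasDerivWithinAt.congr (fun r hr => key r hr) (key t ht)

end Semigroup

variable {H : Type*} [NormedAddCommGroup H] [InnerProductSpace ℂ H] [CompleteSpace H]
  [FiniteDimensional ℂ H]

/-- The predual map, as a linear map on operators on `B(H)`. -/
def predualL : (Op H →L[ℂ] Op H) →ₗ[ℂ] (Op H →L[ℂ] Op H) where
  toFun φ := LinearMap.toContinuousLinearMap (predual (φ : Op H →ₗ[ℂ] Op H))
  map_add' φ ψ := by
    ext1 ρ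
    refine eq_of_tr_mul_eq_tr_mul fun Y => ?_
    change tr (predual _ ρ * Y) = tr ((predual _ ρ + predual _ ρ) * Y)
    rw [add_mul, map_add, tr_mul_comm, tr_mul_comm (predual _ ρ), tr_mul_comm (predual _ ρ),
      ← predual_spec, ← predual_spec, ← predual_spec, ← map_add, ← add_mul]
    rfl
  map_smul' c φ := by
    ext1 ρ
    refine eq_of_tr_mul_eq_tr_mul fun Y => ?_
    change tr (predual _ ρ * Y) = tr ((c • predual _ ρ) * Y)
    rw [smul_mul_assoc, map_smul, tr_mul_comm, tr_mul_comm (predual _ ρ),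
      ← predual_spec, ← predual_spec, ← map_smul, ← smul_mul_assoc]
    rfl

namespace QMS

variable (Q : QMS H)

theorem continuous_Pc : Continuous Q.Pc := continuous_clm_apply.mpr Q.continuous

/-- `P_{*t}` as a continuous linear map. -/
def dualc (t : ℝ≥0) : Op H →L[ℂ] Op H := predualL (Q.Pc t)

theorem continuous_dualc : Continuous Q.dualc :=
  (LinearMap.toContinuousLinearMap (predualL (H := H))).continuous.comp Q.continuous_Pc

theorem exists_hasDerivWithinAt_dual : ∃ G : Op H →L[ℂ] Op H, ∀ (ρ : Op H) (t : ℝ), 0 ≤ t →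
    HasDerivWithinAt (fun r : ℝ => Q.dual r.toNNReal ρ) (Q.dual t.toNNReal (G ρ))
      (Set.Ici 0) t := by
  obtain ⟨G, hG⟩ := exists_generator Q.dualc Q.continuous_dualc
    (ContinuousLinearMap.ext fun ρ => dual_zero ρ)
    (fun s t => ContinuousLinearMap.ext fun ρ => dual_add s t ρ)
  refine ⟨G, fun ρ t ht => ?_⟩
  exact ((ContinuousLinearMap.apply ℂ (Op H) ρ).restrictScalars ℝ).hasFDerivAt.comp_hasDerivWithinAt
    t (hG t ht)

theorem hasDerivWithinAt_dual (ρ : Op H) {t : ℝ} (ht : 0 ≤ t) :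
    HasDerivWithinAt (fun r : ℝ => Q.dual r.toNNReal ρ)
      (Q.dual t.toNNReal (Q.dualGenerator ρ)) (Set.Ici 0) t := by
  obtain ⟨G, hG⟩ := Q.exists_hasDerivWithinAt_dual
  have h0 : Q.dualGenerator ρ = G ρ := by
    rw [dualGenerator, (hG ρ 0 le_rfl).derivWithin (uniqueDiffOn_Ici 0 0 Set.self_mem_Ici),
      Real.toNNReal_zero, dual_zero]
  rw [h0]
  exact hG ρ t ht

theorem continuous_dual (ρ : Op H) : Continuous fun t : ℝ => Q.dual t.toNNReal ρ :=
  (Q.continuous_dualc.clm_apply continuous_const).comp continuous_real_toNNReal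

/-- The generator commutes with the semigroup. -/
theorem dualGenerator_dual (t : ℝ≥0) (ρ : Op H) :
    Q.dualGenerator (Q.dual t ρ) = Q.dual t (Q.dualGenerator ρ) := by
  have h1 := Q.hasDerivWithinAt_dual ρ le_rfl
  rw [Real.toNNReal_zero, dual_zero] at h1
  have h2 : HasDerivWithinAt (fun r : ℝ => Q.dual r.toNNReal (Q.dual t ρ))
      (Q.dual t (Q.dualGenerator ρ)) (Set.Ici 0) 0 := by
    refine (((Q.dualc t).restrictScalars ℝ).hasFDerivAt.comp_hasDerivWithinAt 0 h1).congr
      (fun r _ => ?_) ?_ <;>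
    · change _ = Q.dual t (Q.dual _ ρ)
      rw [← dual_add, ← dual_add, add_comm]
  exact h2.derivWithin (uniqueDiffOn_Ici 0 0 Set.self_mem_Ici)

theorem tr_dualGenerator (ρ : Op H) : tr (Q.dualGenerator ρ) = 0 := by
  have h1 := Q.hasDerivWithinAt_dual ρ le_rfl
  rw [Real.toNNReal_zero, dual_zero] at h1
  have h2 := ((LinearMap.toContinuousLinearMap (tr (H := H))).restrictScalars
    ℝ).hasFDerivAt.comp_hasDerivWithinAt 0 h1
  have h3 : HasDerivWithinAt (fun _ : ℝ => tr ρ) (tr (Q.dualGenerator ρ)) (Set.Ici 0) 0 :=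
    h2.congr (fun r _ => (tr_dual _ ρ).symm) (tr_dual _ ρ).symm
  exact (uniqueDiffOn_Ici (0 : ℝ) 0 Set.self_mem_Ici).eq_deriv _ h3 (hasDerivWithinAt_const _ _ _)

/-- Second order Taylor bound for the semigroup at time zero. -/
theorem exists_norm_dual_sub_le (ρ : Op H) : ∃ C : ℝ, 0 ≤ C ∧ ∀ t ∈ Set.Icc (0 : ℝ) 1,
    ‖Q.dual t.toNNReal ρ - ρ - t • Q.dualGenerator ρ‖ ≤ C * t ^ 2 := by
  set η := Q.dualGenerator ρ with hη
  obtain ⟨C, hC⟩ := (isCompact_Icc (a := (0 : ℝ)) (b := 1)).exists_bound_of_continuousOn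
    (Q.continuous_dual (Q.dualGenerator η)).continuousOn
  have hC0 : 0 ≤ C := (norm_nonneg _).trans (hC 0 (by simp))
  have h1 : ∀ t ∈ Set.Icc (0 : ℝ) 1, ‖Q.dual t.toNNReal η - η‖ ≤ C * t := by
    intro t ht
    have := norm_image_sub_le_of_norm_deriv_right_le_segment (a := (0 : ℝ)) (b := 1)
      (Q.continuous_dual η).continuousOn
      (fun x hx => (Q.hasDerivWithinAt_dual η hx.1).mono (Set.Ici_subset_Ici.mpr hx.1))
      (fun x hx => hC x (Set.Ico_subset_Icc_self hx)) t ht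
    simpa [dual_zero] using this
  refine ⟨C, hC0, fun s hs => ?_⟩
  have h2 := norm_image_sub_le_of_norm_deriv_right_le_segment (a := (0 : ℝ)) (b := s)
    (f := fun t : ℝ => Q.dual t.toNNReal ρ - ρ - t • η)
    (f' := fun t : ℝ => Q.dual t.toNNReal η - η) (C := C * s)
    (((Q.continuous_dual ρ).sub continuous_const).sub
      (continuous_id.smul continuous_const)).continuousOn
    (fun x hx => by
      have h3 := (Q.hasDerivWithinAt_dual ρ hx.1).mono (Set.Ici_subset_Ici.mpr hx.1)
      have h4 := ((hasDerivAt_id x).smul_const η).hasDerivWithinAt (s := Set.Ici x)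
      rw [one_smul] at h4
      exact (h3.sub_const ρ).sub h4)
    (fun x hx => (h1 x ⟨hx.1, hx.2.le.trans hs.2⟩).trans
      (mul_le_mul_of_nonneg_left hx.2.le hC0)) s ⟨hs.1, le_rfl⟩
  rw [sq, ← mul_assoc]
  simpa [dual_zero] using h2

end QMS

section Klein

theorem _root_.Real.sub_le_mul_log_sub {x y : ℝ} (hx : 0 ≤ x) (hy : 0 < y) :
    x - y ≤ x * Real.log x - x * Real.log y := by
  rcases hx.eq_or_lt with rfl | hx
  · simp [hy.le]
  · have h := Real.log_le_sub_one_of_pos (div_pos hy hx)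
    rw [Real.log_div hy.ne' hx.ne'] at h
    have h2 := mul_le_mul_of_nonneg_left h hx.le
    have h3 : x * (y / x - 1) = y - x := by field_simp
    rw [h3] at h2
    linarith

theorem re_tr_cfc_mul_cfc (f g : ℝ → ℝ) (a b : Op H) :
    (tr (cfc f a * cfc g b)).re = ∑ x ∈ (finite_spectrum a).toFinset,
      ∑ y ∈ (finite_spectrum b).toFinset, f x * g y *
        (tr (cfc (Set.indicator {x} 1 : ℝ → ℝ) a * cfc (Set.indicator {y} 1 : ℝ → ℝ) b)).re := by
  rw [cfc_eq_sum_spectral f a, cfc_eq_sum_spectral g b, Finset.sum_mul, map_sum, Complex.re_sum]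
  refine Finset.sum_congr rfl fun x _ => ?_
  rw [Finset.mul_sum, map_sum, Complex.re_sum]
  refine Finset.sum_congr rfl fun y _ => ?_
  rw [smul_mul_smul_comm, ← Complex.coe_smul, map_smul, smul_eq_mul, Complex.re_ofReal_mul]

/-- Klein's inequality `Tr[A] - Tr[B] ≤ Tr[A (log A - log B)]`, with `A` allowed to be singular. By
spectral decomposition it reduces to the scalar case. -/
theorem klein {A B : Op H} (hA : 0 ≤ A) (hB : IsStrictlyPositive B) :
    (tr A).re - (tr B).re ≤ (tr (A * CFC.log A)).re - (tr (A * CFC.log B)).re := by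
  have hAs := hA.isSelfAdjoint
  have hBs := hB.isSelfAdjoint
  have e1 : A * CFC.log A = cfc (fun x => x * Real.log x) A * cfc (fun _ => 1 : ℝ → ℝ) B := by
    rw [cfc_const_one ℝ B, mul_one, cfc_mul _ _ A (continuousOn_spectrum _ A)
      (continuousOn_spectrum _ A), cfc_id' ℝ A, CFC.log]
  have e2 : A * CFC.log B = cfc (fun x => x : ℝ → ℝ) A * cfc Real.log B := by
    rw [cfc_id' ℝ A, CFC.log]
  have e3 : A = cfc (fun x => x : ℝ → ℝ) A * cfc (fun _ => 1 : ℝ → ℝ) B := by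
    rw [cfc_const_one ℝ B, mul_one, cfc_id' ℝ A]
  have e4 : B = cfc (fun _ => 1 : ℝ → ℝ) A * cfc (fun x => x : ℝ → ℝ) B := by
    rw [cfc_const_one ℝ A, one_mul, cfc_id' ℝ B]
  rw [e1, e2]
  conv_lhs => rw [e3]; enter [2]; rw [e4]
  rw [re_tr_cfc_mul_cfc (fun x => x) (fun _ => 1), re_tr_cfc_mul_cfc (fun _ => 1) (fun x => x),
    re_tr_cfc_mul_cfc (fun x => x * Real.log x) (fun _ => 1),
    re_tr_cfc_mul_cfc (fun x => x) Real.log]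
  simp only [← Finset.sum_sub_distrib, ← sub_mul]
  refine Finset.sum_le_sum fun x hx => Finset.sum_le_sum fun y hy => ?_
  refine mul_le_mul_of_nonneg_right ?_ ?_
  · have hx0 : 0 ≤ x := spectrum_nonneg_of_nonneg hA ((finite_spectrum A).mem_toFinset.mp hx)
    have hy0 : 0 < y := hB.spectrum_pos ((finite_spectrum B).mem_toFinset.mp hy)
    simpa using Real.sub_le_mul_log_sub hx0 hy0
  · refine (Complex.nonneg_iff.mp (tr_mul_nonneg ?_ ?_)).1 <;>
    exact cfc_nonneg fun z _ => Set.indicator_nonneg (fun _ _ => zero_le_one) z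

end Klein

end

/-! ### Entropy decay and the logarithmic Sobolev inequality -/

section

variable {H : Type*} [NormedAddCommGroup H] [InnerProductSpace ℂ H] [CompleteSpace H]
  [FiniteDimensional ℂ H]

/-- `A ↦ A log A` is continuous up to the boundary of the positive cone, although `log` is not. -/
theorem continuousOn_mul_log : ContinuousOn (fun A : Op H => A * CFC.log A) {A | 0 ≤ A} := by
  have h : ContinuousOn (cfc (fun x : ℝ => x * Real.log x)) {A : Op H | IsSelfAdjoint A} :=
    continuousOn_id.cfc_of_mem_nhdsSet _ (s := Set.univ) (by simp)
      (by simp) Real.continuous_mul_log.continuousOn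
  refine (h.mono fun A (hA : 0 ≤ A) => hA.isSelfAdjoint).congr fun A (hA : 0 ≤ A) => ?_
  have hs : IsSelfAdjoint A := hA.isSelfAdjoint
  change A * CFC.log A = _
  rw [cfc_mul _ _ A (continuousOn_spectrum _ A) (continuousOn_spectrum _ A), cfc_id' ℝ A, CFC.log]

/-- The continuous real functional `X ↦ Re Tr[X K]`. -/
def reTrMul (K : Op H) : Op H →L[ℝ] ℝ :=
  Complex.reCLM.comp ((LinearMap.toContinuousLinearMap
    (tr ∘ₗ LinearMap.mulRight ℂ K)).restrictScalars ℝ)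

omit [CompleteSpace H] in
theorem reTrMul_apply (K X : Op H) : reTrMul K X = (tr (X * K)).re := rfl

omit [FiniteDimensional ℂ H] in
theorem isStrictlyPositive_convexCombination {ρ σ : Op H} (hρ : 0 ≤ ρ) (hσ : IsStrictlyPositive σ)
    {ε : ℝ} (hε : 0 < ε) (hε1 : ε ≤ 1) : IsStrictlyPositive ((1 - ε) • ρ + ε • σ) :=
  (hσ.smul hε).nonneg_add (smul_nonneg (sub_nonneg.mpr hε1) hρ)

namespace QMS

variable {Q : QMS H} {σ : Op H}

omit [CompleteSpace H] in
theorem finrank_pos_of_isState {ρ : Op H} (hρ : IsState ρ) : 0 < Module.finrank ℂ H := by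
  rw [pos_iff_ne_zero]
  intro h0
  have : Subsingleton H := Module.finrank_zero_iff.mp h0
  have h1 : ρ = 0 := by ext v; exact Subsingleton.elim _ _
  have h2 := hρ.2
  rw [h1, map_zero] at h2
  exact zero_ne_one h2

/-- The scalar part of `log σ_Tr` does not contribute to the entropy production. -/
theorem entropyProduction_eq (hσ : Q.IsInvariantState σ) (hσf : IsStrictlyPositive σ) {ρ : Op H}
    (h : ∀ v : H, ρ v = 0 → ⟪v, Q.dualGenerator ρ v⟫_ℂ = 0) :
    Q.entropyProduction σ ρ = ((-(reTrMul (CFC.log ρ - CFC.log (Q.dfDual σ 1))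
      (Q.dualGenerator ρ)) : ℝ) : EReal) := by
  rw [entropyProduction, if_pos h]
  have hd : (0 : ℝ) < (Module.finrank ℂ H : ℝ)⁻¹ :=
    inv_pos.mpr (Nat.cast_pos.mpr (finrank_pos_of_isState hσ.1))
  have e : Q.refState σ = (Module.finrank ℂ H : ℝ)⁻¹ • Q.dfDual σ 1 := by
    rw [refState, map_smul, ← Complex.coe_smul]
    push_cast
    rfl
  rw [e, CFC.log_smul' _ hd (dfDual_one_isStrictlyPositive hσ hσf), reTrMul_apply]
  congr 3
  rw [← sub_sub, sub_right_comm, mul_sub _ _ (algebraMap ℝ _ _), map_sub,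
    Algebra.algebraMap_eq_smul_one, ← Complex.coe_smul, mul_smul_comm, map_smul, mul_one,
    Q.tr_dualGenerator, smul_zero, sub_zero]

/-- The value of the decoherence-free relative entropy of `ρ`, when `h` is the density of `ρ` on
the decoherence-free algebra. -/
def entropyValue (Q : QMS H) (σ ρ h : Op H) : ℝ :=
  (tr (ρ * CFC.log ρ)).re - (tr (h * CFC.log h)).re - reTrMul (CFC.log (Q.dfDual σ 1)) ρ

/-- Along a trajectory the density enters the relative entropy only through a constant. -/
theorem dfEntropy_dual_eq (hσ : Q.IsInvariantState σ) (hσf : IsStrictlyPositive σ) {ρ h : Op H}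
    (hρ : 0 ≤ ρ) (hh : h ∈ Q.dfStarSubalgebra)
    (hd : ∀ Y ∈ Q.dfStarSubalgebra, tr (ρ * Y) = tr (h * Y)) (t : ℝ≥0) :
    Q.dfEntropy σ (Q.dual t ρ) = (Q.entropyValue σ (Q.dual t ρ) h : EReal) := by
  obtain ⟨k, hk, kd⟩ := exists_density Q.dfStarSubalgebra (Q.dual t ρ)
  have hk0 := density_nonneg hσ hσf (dual_nonneg t hρ) hk kd
  rw [dfEntropy_eq hσ hσf (dual_nonneg t hρ) hk kd,
    ← tr_mul_log_density_eq hσ hσf t hh hk hk0 hd kd]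
  rfl

theorem dfEntropy_eq_entropyValue (hσ : Q.IsInvariantState σ) (hσf : IsStrictlyPositive σ)
    {ρ h : Op H} (hρ : 0 ≤ ρ) (hh : h ∈ Q.dfStarSubalgebra)
    (hd : ∀ Y ∈ Q.dfStarSubalgebra, tr (ρ * Y) = tr (h * Y)) :
    Q.dfEntropy σ ρ = (Q.entropyValue σ ρ h : EReal) := by
  have := dfEntropy_dual_eq hσ hσf hρ hh hd 0
  rwa [dual_zero] at this

theorem continuous_entropyValue {X : Type*} [TopologicalSpace X] {ρ h : X → Op H}
    (hρ : Continuous ρ) (hh : Continuous h) (hρ0 : ∀ x, 0 ≤ ρ x) (hh0 : ∀ x, 0 ≤ h x) :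
    Continuous fun x => Q.entropyValue σ (ρ x) (h x) := by
  have key : ∀ r : X → Op H, Continuous r → (∀ x, 0 ≤ r x) →
      Continuous fun x => (tr (r x * CFC.log (r x))).re := fun r hr hr0 =>
    Complex.continuous_re.comp (continuousOn_mul_log.comp_continuous hr hr0).opTr
  exact ((key ρ hρ hρ0).sub (key h hh hh0)).sub ((reTrMul _).continuous.comp hρ)

/-- Exponential decay for faithful initial states: Klein's inequality bounds the upper right
derivative of the relative entropy by minus the entropy production, and Grönwall applies. -/
theorem entropyValue_dual_le_of_faithful (hσ : Q.IsInvariantState σ)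
    (hσf : IsStrictlyPositive σ) {α : ℝ} (hM : Q.MLSI σ α) {ρ h : Op H} (hρ : IsState ρ)
    (hρf : IsStrictlyPositive ρ) (hh : h ∈ Q.dfStarSubalgebra)
    (hd : ∀ Y ∈ Q.dfStarSubalgebra, tr (ρ * Y) = tr (h * Y)) (t : ℝ≥0) :
    Q.entropyValue σ (Q.dual t ρ) h ≤ Real.exp (-2 * α * t) * Q.entropyValue σ ρ h := by
  set R : ℝ → Op H := fun r => Q.dual r.toNNReal ρ with hR
  set K : Op H := CFC.log (Q.dfDual σ 1) with hK
  have hRpos : ∀ r, IsStrictlyPositive (R r) := fun r => dual_isStrictlyPositive hσ hσf _ hρf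
  have hRst : ∀ r, IsState (R r) := fun r => isState_dual _ hρ
  have hRc : Continuous R := Q.continuous_dual ρ
  have hh0 := density_nonneg hσ hσf hρ.1 hh hd
  have hlogc : Continuous fun r => CFC.log (R r) :=
    CFC.continuousOn_log.comp_continuous hRc fun r => ⟨(hRpos r).isSelfAdjoint, (hRpos r).isUnit⟩
  have hfc : Continuous fun r => Q.entropyValue σ (R r) h :=
    continuous_entropyValue hRc continuous_const (fun r => (hRpos r).nonneg) fun _ => hh0
  have hbound : ∀ x, reTrMul (CFC.log (R x) - K) (Q.dualGenerator (R x))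
      ≤ (-2 * α) * Q.entropyValue σ (R x) h + 0 := by
    intro x
    have h1 := hM (R x) (hRst x)
    -- the kernel condition is void, since `ρ_x` is faithful
    rw [dfEntropy_dual_eq hσ hσf hρ.1 hh hd, entropyProduction_eq hσ hσf (fun v hv => by
      rw [injective_of_isStrictlyPositive (hRpos x) hv]; simp), ← EReal.coe_mul,
      EReal.coe_le_coe_iff] at h1
    change 2 * α * Q.entropyValue σ (R x) h ≤ _ at h1
    linarith
  have hslope : ∀ x ∈ Set.Ico (0 : ℝ) t, ∀ r,
      reTrMul (CFC.log (R x) - K) (Q.dualGenerator (R x)) < r →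
      ∃ᶠ z in 𝓝[>] x, (z - x)⁻¹ * (Q.entropyValue σ (R z) h - Q.entropyValue σ (R x) h) < r := by
    intro x hx r hr
    have hder : HasDerivWithinAt R (Q.dualGenerator (R x)) (Set.Ioi x) x := by
      have h1 := Q.hasDerivWithinAt_dual ρ hx.1
      rw [← dualGenerator_dual] at h1
      exact h1.mono (fun y (hy : x < y) => hx.1.trans hy.le)
    have hlim : Tendsto (fun z => (tr (((z - x)⁻¹ • (R z - R x)) * (CFC.log (R z) - K))).re)
        (𝓝[>] x) (𝓝 (tr (Q.dualGenerator (R x) * (CFC.log (R x) - K))).re) := by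
      have h1 := hasDerivWithinAt_iff_tendsto_slope' (Set.self_notMem_Ioi) |>.mp hder
      have h2 : Tendsto (fun z => CFC.log (R z) - K) (𝓝[>] x) (𝓝 (CFC.log (R x) - K)) :=
        ((hlogc.sub continuous_const).tendsto x).mono_left nhdsWithin_le_nhds
      have h3 := h1.mul h2
      have h4 : Continuous fun A : Op H => (tr A).re := Complex.continuous_re.comp continuous_tr
      exact (h4.tendsto _).comp h3
    refine Eventually.frequently ?_
    filter_upwards [hlim.eventually (gt_mem_nhds hr), self_mem_nhdsWithin] with z hz hxz
    refine lt_of_le_of_lt ?_ hz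
    have hzx : 0 < z - x := sub_pos.mpr hxz
    -- `D(ρ_x ‖ ρ_z) ≥ 0`
    have hkl := klein (hRpos x).nonneg (hRpos z)
    rw [(hRst x).2, (hRst z).2, sub_self, sub_nonneg] at hkl
    rw [smul_mul_assoc, ← Complex.coe_smul, map_smul, smul_eq_mul, Complex.re_ofReal_mul]
    refine mul_le_mul_of_nonneg_left ?_ (inv_nonneg.mpr hzx.le)
    simp only [entropyValue, reTrMul_apply, sub_mul, mul_sub, map_sub, Complex.sub_re, ← hK]
    linarith
  have hG := le_gronwallBound_of_liminf_deriv_right_le hfc.continuousOn hslope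
    (δ := Q.entropyValue σ (R 0) h) le_rfl (fun x _ => hbound x) t ⟨t.2, le_rfl⟩
  rw [gronwallBound_ε0, sub_zero, mul_comm] at hG
  simpa [hR, dual_zero] using hG

/-- Exponential decay for all initial states, by continuity of the relative entropy along
`(1 - ε) ρ + ε σ`. -/
theorem entropyValue_dual_le (hσ : Q.IsInvariantState σ)
    (hσf : IsStrictlyPositive σ) {α : ℝ} (hM : Q.MLSI σ α) {ρ h : Op H} (hρ : IsState ρ)
    (hh : h ∈ Q.dfStarSubalgebra)
    (hd : ∀ Y ∈ Q.dfStarSubalgebra, tr (ρ * Y) = tr (h * Y)) (t : ℝ≥0) :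
    Q.entropyValue σ (Q.dual t ρ) h ≤ Real.exp (-2 * α * t) * Q.entropyValue σ ρ h := by
  obtain ⟨k, hk, kd⟩ := exists_density Q.dfStarSubalgebra σ
  have hh0 := density_nonneg hσ hσf hρ.1 hh hd
  have hk0 := density_nonneg hσ hσf hσ.1.1 hk kd
  let mix : Op H → Op H → Set.Icc (0 : ℝ) 1 → Op H := fun A B ε =>
    (1 - (ε : ℝ)) • A + (ε : ℝ) • B
  have hmixc : ∀ A B, Continuous (mix A B) := fun A B => by fun_prop
  have hmix0 : ∀ A B, 0 ≤ A → 0 ≤ B → ∀ ε, 0 ≤ mix A B ε := fun A B hA hB ε =>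
    add_nonneg (smul_nonneg (sub_nonneg.mpr ε.2.2) hA) (smul_nonneg ε.2.1 hB)
  have hmixtr : ∀ A B ε, tr (mix A B ε) = (1 - ((ε : ℝ) : ℂ)) * tr A + ((ε : ℝ) : ℂ) * tr B := by
    intro A B ε
    simp only [mix, map_add, ← Complex.coe_smul, map_smul, smul_eq_mul]
    push_cast
    rfl
  have hmul : ∀ A B ε Y, mix A B ε * Y = mix (A * Y) (B * Y) ε := by
    intro A B ε Y
    simp only [mix, add_mul, smul_mul_assoc]
  have hc1 : Continuous fun ε => Q.entropyValue σ (Q.dual t (mix ρ σ ε)) (mix h k ε) :=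
    continuous_entropyValue ((Q.dualc t).continuous.comp (hmixc _ _)) (hmixc _ _)
      (fun ε => dual_nonneg t (hmix0 _ _ hρ.1 hσ.1.1 ε)) (hmix0 _ _ hh0 hk0)
  have hc2 : Continuous fun ε => Real.exp (-2 * α * t) *
      Q.entropyValue σ (mix ρ σ ε) (mix h k ε) :=
    continuous_const.mul (continuous_entropyValue (hmixc _ _) (hmixc _ _)
      (hmix0 _ _ hρ.1 hσ.1.1) (hmix0 _ _ hh0 hk0))
  have hle : ∀ ε : Set.Icc (0 : ℝ) 1, 0 < (ε : ℝ) →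
      Q.entropyValue σ (Q.dual t (mix ρ σ ε)) (mix h k ε) ≤
        Real.exp (-2 * α * t) * Q.entropyValue σ (mix ρ σ ε) (mix h k ε) := by
    intro ε hε
    refine entropyValue_dual_le_of_faithful hσ hσf hM ⟨hmix0 _ _ hρ.1 hσ.1.1 ε, ?_⟩
      (isStrictlyPositive_convexCombination hρ.1 hσf hε ε.2.2) ?_ (fun Y hY => ?_) t
    · rw [hmixtr, hρ.2, hσ.1.2]; ring
    · simp only [mix, ← Complex.coe_smul]
      exact add_mem (SMulMemClass.smul_mem _ hh) (SMulMemClass.smul_mem _ hk)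
    · rw [hmul, hmul, hmixtr, hmixtr, hd Y hY, kd Y hY]
  have hclosed := isClosed_le hc1 hc2
  have hz : (0 : Set.Icc (0 : ℝ) 1) ∈ closure {ε : Set.Icc (0 : ℝ) 1 | 0 < (ε : ℝ)} := by
    refine mem_closure_of_tendsto (b := atTop)
      (f := fun n : ℕ => (⟨1 / ((n : ℝ) + 1), by positivity, by
        rw [div_le_one (by positivity)]; linarith [n.cast_nonneg (α := ℝ)]⟩ : Set.Icc (0 : ℝ) 1))
      ?_ (Eventually.of_forall fun n => ?_)
    · rw [tendsto_subtype_rng]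
      exact tendsto_one_div_add_atTop_nhds_zero_nat
    · change (0 : ℝ) < 1 / ((n : ℝ) + 1)
      positivity
  have hmix_zero : ∀ A B, mix A B 0 = A := fun A B => by simp [mix]
  have hfin : Q.entropyValue σ (Q.dual t (mix ρ σ 0)) (mix h k 0) ≤
      Real.exp (-2 * α * t) * Q.entropyValue σ (mix ρ σ 0) (mix h k 0) :=
    closure_minimal (s := {ε : Set.Icc (0 : ℝ) 1 | 0 < (ε : ℝ)}) (fun ε hε => hle ε hε) hclosed hz
  rwa [hmix_zero, hmix_zero] at hfin

/-- Under the kernel condition in the definition of the entropy production, the mass that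
`P_{*t}(ρ)` puts on the kernel of `ρ` is of second order in `t`. -/
theorem exists_kernel_mass_le {ρ q : Op H}
    (h : ∀ v : H, ρ v = 0 → ⟪v, Q.dualGenerator ρ v⟫_ℂ = 0) (hq : IsSelfAdjoint q)
    (hqq : q * q = q) (hρq : ρ * q = 0) : ∃ C : ℝ, ∀ t ∈ Set.Icc (0 : ℝ) 1,
      reTrMul q (Q.dual t.toNNReal ρ) ≤ C * t ^ 2 := by
  have hL : tr (Q.dualGenerator ρ * q) = 0 := by
    have e : Q.dualGenerator ρ * q = Q.dualGenerator ρ * q * q := by rw [mul_assoc, hqq]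
    rw [e, tr_mul_comm, tr_eq_sum_inner]
    refine Finset.sum_eq_zero fun i _ => ?_
    set e := stdOrthonormalBasis ℂ H i
    have h1 : ⟪e, (q * (Q.dualGenerator ρ * q)) e⟫_ℂ = ⟪q e, Q.dualGenerator ρ (q e)⟫_ℂ := by
      have h2 := ContinuousLinearMap.adjoint_inner_right q e (Q.dualGenerator ρ (q e))
      rw [← ContinuousLinearMap.star_eq_adjoint, hq.star_eq] at h2
      exact h2
    rw [h1]
    refine h _ ?_
    change (ρ * q) e = 0
    rw [hρq]
    rfl
  obtain ⟨C, hC0, hC⟩ := Q.exists_norm_dual_sub_le ρ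
  refine ⟨‖reTrMul q‖ * C, fun t ht => ?_⟩
  have e : reTrMul q (Q.dual t.toNNReal ρ)
      = reTrMul q (Q.dual t.toNNReal ρ - ρ - t • Q.dualGenerator ρ) := by
    rw [map_sub, map_sub, map_smul, reTrMul_apply q ρ, hρq, reTrMul_apply q (Q.dualGenerator ρ),
      hL]
    simp
  rw [e, mul_assoc]
  exact (Real.le_norm_self _).trans (((reTrMul q).le_opNorm _).trans
    (mul_le_mul_of_nonneg_left (hC t ht) (norm_nonneg _)))

/-- Lower bound for the entropy near a possibly singular positive operator, from Klein's inequality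
with the kernel of `ρ` lifted to the eigenvalue `s`. -/
theorem klein_lift {ρ A : Op H} (hρ : 0 ≤ ρ) (hA : 0 ≤ A) (htr : tr A = tr ρ) {s : ℝ}
    (hs : 0 < s) :
    reTrMul (CFC.log ρ) A
      + Real.log s * reTrMul (cfc (Set.indicator {0} 1 : ℝ → ℝ) ρ) A
      - s * (tr (cfc (Set.indicator {0} 1 : ℝ → ℝ) ρ)).re ≤ (tr (A * CFC.log A)).re := by
  have hsa : IsSelfAdjoint ρ := hρ.isSelfAdjoint
  set q : Op H := cfc (Set.indicator {0} 1 : ℝ → ℝ) ρ with hq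
  set B : Op H := cfc (fun x : ℝ => x + s * Set.indicator {0} 1 x) ρ with hB
  have hBpos : IsStrictlyPositive B := by
    rw [hB, cfc_isStrictlyPositive_iff _ ρ (continuousOn_spectrum _ ρ)]
    intro x hx
    have : 0 ≤ x := spectrum_nonneg_of_nonneg hρ hx
    by_cases h0 : x = 0
    · simp [h0, hs]
    · simpa [h0] using lt_of_le_of_ne this (Ne.symm h0)
  have hBeq : B = ρ + s • q := by
    rw [hB, cfc_add _ _ _ (continuousOn_spectrum _ ρ) (continuousOn_spectrum _ ρ), cfc_id' ℝ ρ,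
      cfc_const_mul _ _ _ (continuousOn_spectrum _ ρ)]
  have hlog : CFC.log B = CFC.log ρ + Real.log s • q := by
    rw [CFC.log, hB, ← cfc_comp' Real.log _ ρ ((((finite_spectrum ρ).image _).continuousOn _))
      (continuousOn_spectrum _ ρ), CFC.log, hq,
      ← cfc_const_mul _ _ _ (continuousOn_spectrum _ ρ),
      ← cfc_add _ _ _ (continuousOn_spectrum _ ρ) (continuousOn_spectrum _ ρ)]
    refine cfc_congr fun x _ => ?_
    by_cases h0 : x = 0 <;> simp [h0]
  have hk := klein hA hBpos
  rw [hlog, htr, hBeq, map_add, mul_add, map_add, mul_smul_comm, ← Complex.coe_smul,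
    ← Complex.coe_smul, map_smul, map_smul, smul_eq_mul, smul_eq_mul, Complex.add_re,
    Complex.add_re, Complex.re_ofReal_mul, Complex.re_ofReal_mul] at hk
  simp only [reTrMul_apply]
  linarith

/-- The modified logarithmic Sobolev inequality at a state, from exponential decay: the first order
loss of relative entropy is at most the entropy production. -/
theorem entropyValue_le_of_decay {α : ℝ} {ρ h : Op H} (hρ : IsState ρ)
    (hdec : ∀ t : ℝ≥0, Q.entropyValue σ (Q.dual t ρ) h ≤
      Real.exp (-2 * α * t) * Q.entropyValue σ ρ h)
    (hker : ∀ v : H, ρ v = 0 → ⟪v, Q.dualGenerator ρ v⟫_ℂ = 0) :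
    2 * α * Q.entropyValue σ ρ h ≤
      -(reTrMul (CFC.log ρ - CFC.log (Q.dfDual σ 1)) (Q.dualGenerator ρ)) := by
  set K : Op H := CFC.log ρ - CFC.log (Q.dfDual σ 1) with hK
  set q : Op H := cfc (Set.indicator {0} 1 : ℝ → ℝ) ρ with hq
  set f := Q.entropyValue σ ρ h with hf
  have hsa : IsSelfAdjoint ρ := hρ.1.isSelfAdjoint
  have hρq : ρ * q = 0 := by
    conv_lhs => rw [← cfc_id ℝ ρ]
    rw [hq, ← cfc_mul _ _ ρ (continuousOn_spectrum _ ρ) (continuousOn_spectrum _ ρ),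
      ← cfc_const_zero ℝ ρ]
    refine cfc_congr fun x _ => ?_
    by_cases h0 : x = 0 <;> simp [h0]
  obtain ⟨C, hC⟩ := exists_kernel_mass_le hker (cfc_predicate _ ρ)
    (isIdempotentElem_cfc_indicator {0} ρ) hρq
  -- the slope of the relative entropy at time `t`, bounded below by Klein's inequality with
  -- `s = t ^ 2` and above by the assumed decay
  have hmain : ∀ᶠ t : ℝ in 𝓝[>] 0,
      reTrMul K (t⁻¹ • (Q.dual t.toNNReal ρ - ρ)) + C * 2 * (t * Real.log t) - t * (tr q).re
        ≤ t⁻¹ * (Real.exp (-2 * α * t) - 1) * f := by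
    filter_upwards [Ioo_mem_nhdsGT (zero_lt_one (α := ℝ))] with t ht
    have ht0 : 0 < t := ht.1
    have h1 := klein_lift hρ.1 (dual_nonneg (Q := Q) t.toNNReal hρ.1) (tr_dual _ _) (s := t ^ 2)
      (by positivity)
    rw [Real.log_pow, ← hq] at h1
    have h2 := hdec t.toNNReal
    rw [Real.coe_toNNReal t ht0.le] at h2
    have h3 : C * t ^ 2 * (2 * Real.log t) ≤
        2 * Real.log t * reTrMul q (Q.dual t.toNNReal ρ) := by
      rw [mul_comm]
      exact mul_le_mul_of_nonpos_left (hC t ⟨ht0.le, ht.2.le⟩)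
        (by linarith [Real.log_neg ht0 ht.2])
    have h4 : reTrMul K (Q.dual t.toNNReal ρ - ρ) + C * t ^ 2 * (2 * Real.log t)
        - t ^ 2 * (tr q).re ≤ (Real.exp (-2 * α * t) - 1) * f := by
      have h5 : (tr (ρ * CFC.log ρ)).re = reTrMul (CFC.log ρ) ρ := rfl
      have h6 : ∀ X, reTrMul K X
          = reTrMul (CFC.log ρ) X - reTrMul (CFC.log (Q.dfDual σ 1)) X := fun X => by
        simp only [hK, reTrMul_apply, mul_sub, map_sub, Complex.sub_re]
      rw [sub_mul, one_mul, map_sub, h6, h6]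
      push_cast at h1
      rw [hf] at h2 ⊢
      simp only [entropyValue] at h2 ⊢
      linarith
    have h7 := mul_le_mul_of_nonneg_left h4 (inv_nonneg.mpr ht0.le)
    rw [map_smul, smul_eq_mul, mul_assoc (t⁻¹)]
    refine le_trans (le_of_eq ?_) h7
    field_simp
  have hL1 : Tendsto (fun t : ℝ => reTrMul K (t⁻¹ • (Q.dual t.toNNReal ρ - ρ)) +
      C * 2 * (t * Real.log t) - t * (tr q).re) (𝓝[>] 0)
      (𝓝 (reTrMul K (Q.dualGenerator ρ) + C * 2 * (0 * Real.log 0) - 0 * (tr q).re)) := by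
    have h1 := Q.hasDerivWithinAt_dual ρ le_rfl
    rw [Real.toNNReal_zero, dual_zero] at h1
    have h2 := (hasDerivWithinAt_iff_tendsto_slope' Set.self_notMem_Ioi).mp
      (h1.mono Set.Ioi_subset_Ici_self)
    have h3 : Tendsto (fun t : ℝ => t⁻¹ • (Q.dual t.toNNReal ρ - ρ)) (𝓝[>] 0)
        (𝓝 (Q.dualGenerator ρ)) := by
      refine h2.congr fun t => ?_
      simp [slope, dual_zero]
    refine ((((reTrMul K).continuous.tendsto _).comp h3).add ?_).sub ?_
    · exact ((continuous_const.mul Real.continuous_mul_log).tendsto 0).mono_left nhdsWithin_le_nhds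
    · exact ((continuous_id.mul continuous_const).tendsto 0).mono_left nhdsWithin_le_nhds
  have hL2 : Tendsto (fun t : ℝ => t⁻¹ * (Real.exp (-2 * α * t) - 1) * f) (𝓝[>] 0)
      (𝓝 (-2 * α * f)) := by
    have h1 : HasDerivAt (fun t : ℝ => Real.exp (-2 * α * t)) (-2 * α) 0 := by
      simpa using ((hasDerivAt_id (0 : ℝ)).const_mul (-2 * α)).exp
    have h2 := (hasDerivWithinAt_iff_tendsto_slope' Set.self_notMem_Ioi).mp
      (h1.hasDerivWithinAt (s := Set.Ioi 0))
    refine (h2.congr fun t => ?_).mul_const f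
    simp [slope]
  have := le_of_tendsto_of_tendsto hL1 hL2 hmain
  simp only [zero_mul, mul_zero, add_zero, sub_zero] at this
  linarith

end QMS

end

end

end DFEntropy


theorem theorem3p2 {H : Type*} [NormedAddCommGroup H] [InnerProductSpace ℂ H]
    [CompleteSpace H] [FiniteDimensional ℂ H]
    (Q : DFEntropy.QMS H) (σ : DFEntropy.Op H)
    (hσ : Q.IsInvariantState σ) (hσ_faithful : IsStrictlyPositive σ)
    (α : ℝ) (hα : 0 < α) :
    Q.MLSI σ α ↔
      ∀ ρ : DFEntropy.Op H, DFEntropy.IsState ρ → ∀ t : NNReal,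
        Q.dfEntropy σ (Q.dual t ρ) ≤
          ((Real.exp (-2 * α * (t : ℝ)) : ℝ) : EReal) * Q.dfEntropy σ ρ := by
  constructor
  · intro hM ρ hρ t
    obtain ⟨h, hh, hd⟩ := DFEntropy.exists_density Q.dfStarSubalgebra ρ
    rw [DFEntropy.QMS.dfEntropy_dual_eq hσ hσ_faithful hρ.1 hh hd,
      DFEntropy.QMS.dfEntropy_eq_entropyValue hσ hσ_faithful hρ.1 hh hd, ← EReal.coe_mul,
      EReal.coe_le_coe_iff]
    exact DFEntropy.QMS.entropyValue_dual_le hσ hσ_faithful hM hρ hh hd t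
  · intro hdec ρ hρ
    by_cases hker : ∀ v : H, ρ v = 0 → inner ℂ v (Q.dualGenerator ρ v) = 0
    · obtain ⟨h, hh, hd⟩ := DFEntropy.exists_density Q.dfStarSubalgebra ρ
      rw [DFEntropy.QMS.dfEntropy_eq_entropyValue hσ hσ_faithful hρ.1 hh hd,
        DFEntropy.QMS.entropyProduction_eq hσ hσ_faithful hker, ← EReal.coe_mul,
        EReal.coe_le_coe_iff]
      refine DFEntropy.QMS.entropyValue_le_of_decay hρ (fun t => ?_) hker
      have h1 := hdec ρ hρ t
      rwa [DFEntropy.QMS.dfEntropy_dual_eq hσ hσ_faithful hρ.1 hh hd,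
        DFEntropy.QMS.dfEntropy_eq_entropyValue hσ hσ_faithful hρ.1 hh hd, ← EReal.coe_mul,
        EReal.coe_le_coe_iff] at h1
    · rw [DFEntropy.QMS.entropyProduction, if_neg hker]
      exact le_top
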